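/- **Setting.** Let $K$ be one of the following. (i) A number field. Let $\mathcal{O}_K$ be its ring of integers, $S$ the set of its archimedean places, and $q := e$. For $\mathfrak{p} \in S$ with corresponding embedding $\sigma : K \to \mathbb{C}$, put $\deg\mathfrak{p} := 1$ if $\sigma(K) \subseteq \mathbb{R}$ and $\deg\mathfrak{p} := 2$ otherwise, and $\nu_\mathfrak{p}(f) := -\log|\sigma(f)|$ for $f \in K^*$. For a non-zero prime ideal (finite place) $\mathfrak{p}$ of $\mathcal{O}_K$, put $\deg\mathfrak{p} := \log|\mathcal{O}_K/\mathfrak{p}|$. (ii) An algebraic function field in one variable over an arbitrary field $k$ that is its exact field of constants (i.e. $k$ is algebraically closed in $K$). Let $x \in K$ be transcendental over $k$, so that $K/k(x)$ is finite (not necessarily separable), let $\mathcal{O}_K$ be the integral closure of $k[x]$ in $K$, $S$ the set of places of $K/k$ lying over the infinite place of $k(x)$ (the poles of $x$), and $q > 1$ a real number (usually $q = |k|$ if $k$ is finite). For a place $\mathfrak{p}$ of $K/k$, let $\nu_\mathfrak{p}$ be its normalized discrete valuation and $\deg\mathfrak{p}$ the degree over $k$ of its residue field. The places outside $S$ correspond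 to the non-zero prime ideals of $\mathcal{O}_K$. In both cases put $|f|_\mathfrak{p} := q^{-\nu_\mathfrak{p}(f)\deg\mathfrak{p}}$ for $\mathfrak{p} \in S$, $f \in K^*$, and $|0|_\mathfrak{p} := 0$. Write $S = \{\mathfrak{p}_1, \dots, \mathfrak{p}_{n+1}\}$. "Ideal" means non-zero fractional ideal of $\mathcal{O}_K$. For an ideal $\mathfrak{a}$ and $t_1, \dots, t_{n+1}$ in $\mathbb{R}$ (case (i)) or $\mathbb{Z}$ (case (ii)), let $$B(\mathfrak{a}, (t_1, \dots, t_{n+1})) := \{ h \in \mathfrak{a} \mid |h|_{\mathfrak{p}_i} \le q^{t_i \deg\mathfrak{p}_i} \text{ for } 1 \le i \le n+1 \}.$$ An element $\mu \in \mathfrak{a}\setminus\{0\}$ is a *minimum* of $\mathfrak{a}$ if every $h \in B(\mathfrak{a}, (-\nu_{\mathfrak{p}_1}(\mu), \dots, -\nu_{\mathfrak{p}_{n+1}}(\mu)))$ satisfies $h = 0$ or $|h|_\mathfrak{p} = |\mu|_\mathfrak{p}$ for all $\mathfrak{p} \in S$. An ideal $\mathfrak{a}$ is *reduced* if $1 \in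 \mathfrak{a}$ and $1$ is a minimum of $\mathfrak{a}$. For ideals $\mathfrak{b}, \mathfrak{b}'$ write $\mathfrak{b} \sim \mathfrak{b}'$ if there is $h \in K^*$ with $\mathfrak{b} = h\mathfrak{b}'$ and $|h|_\mathfrak{p} = 1$ for all $\mathfrak{p} \in S$. For an ideal $\mathfrak{b} = \prod_{\mathfrak{p} \notin S} \mathfrak{p}^{n_\mathfrak{p}}$ (product over the non-zero prime ideals of $\mathcal{O}_K$), let $\operatorname{div}(\mathfrak{b}) := -\sum_{\mathfrak{p} \notin S} n_\mathfrak{p}\,\mathfrak{p}$, so that $\deg\operatorname{div}(\mathfrak{b}) = -\sum_{\mathfrak{p} \notin S} n_\mathfrak{p}\deg\mathfrak{p}$. **Proposition.** Let $\mathfrak{b}$ and $\mathfrak{b}'$ be two reduced ideals. Then $\mathfrak{b} \sim \mathfrak{b}'$ if and only if $$B(\mathfrak{b}\,\mathfrak{b}'^{-1}, (0, \dots, 0)) \ne \{0\} \quad\text{and}\quad \deg\operatorname{div}(\mathfrak{b}) = \deg\operatorname{div}(\mathfrak{b}').$$ -/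

import Mathlib

open scoped nonZeroDivisors Polynomial WithZero RatFunc NumberField
open IsDedekindDomain

noncomputable section

namespace FunctionField

/-!
### The integral closure of `k[X]` is a Dedekind domain

Mathlib has this instance for separable extensions of `k(X)` only; the facts of this section remove
that hypothesis, so that factorizations of fractional ideals are available in general.
-/

section Dedekind

variable (k K : Type*) [Field k] [Field K] [Algebra k[X] K] [Algebra k⟮X⟯ K]
    [IsScalarTower k[X] k⟮X⟯ K] [FunctionField k K]

theorem rank_ringOfIntegers_le :
    Module.rank k[X] (ringOfIntegers k K) ≤ (Module.finrank k⟮X⟯ K : ℕ) := by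
  refine rank_le fun s hs ↦ ?_
  have h1 := hs.map' (ringOfIntegers k K).val.toLinearMap
    (LinearMap.ker_eq_bot.mpr Subtype.val_injective)
  have h2 := (LinearIndependent.iff_fractionRing k[X] k⟮X⟯).mp h1
  simpa using h2.fintype_card_le_finrank

theorem finite_quotient_of_rank_le {k O : Type*} [Field k] [CommRing O] [Algebra k[X] O]
    [Module.IsTorsionFree k[X] O] [Algebra k O] [IsScalarTower k k[X] O] {n : ℕ}
    (hn : Module.rank k[X] O ≤ n) (a : k[X]) (ha : a ≠ 0) :
    Module.Finite k (O ⧸ Ideal.span {algebraMap k[X] O a}) := by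
  set I : Ideal O := Ideal.span {algebraMap k[X] O a}
  let π : O →ₗ[k] O ⧸ I := (Ideal.Quotient.mkₐ k I).toLinearMap
  have hπ : Function.Surjective π := Ideal.Quotient.mkₐ_surjective k I
  suffices h : Module.rank k (O ⧸ I) ≤ (n * a.natDegree : ℕ) from
    Module.rank_lt_aleph0_iff.mp (h.trans_lt (Cardinal.natCast_lt_aleph0))
  refine rank_le fun s hs ↦ ?_
  choose g hg using hπ
  classical
  let N : Submodule k[X] O := Submodule.span k[X] (s.image g : Set O)
  have : Module.Finite k[X] N := Module.Finite.span_of_finite _ (Finset.finite_toSet _)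
  have : Module.Free k[X] N := inferInstance
  let b := Module.finBasis k[X] N
  have hcard : Module.finrank k[X] N ≤ n := by
    have := (Submodule.rank_le N).trans hn
    rw [← Module.finrank_eq_rank] at this
    exact_mod_cast this
  let w : Fin (Module.finrank k[X] N) × Fin a.natDegree → O ⧸ I :=
    fun p ↦ π ((Polynomial.X ^ (p.2 : ℕ) : k[X]) • (b p.1 : O))
  have hsmul : ∀ (c : k[X]) (y : Fin (Module.finrank k[X] N)),
      π (c • (b y : O)) ∈ Submodule.span k (Set.range w) := by
    intro c y
    have h1 : c • (b y : O) = (c % a) • (b y : O) + algebraMap k[X] O a * ((c / a) • (b y : O)) := by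
      conv_lhs => rw [← EuclideanDomain.mod_add_div c a]
      simp only [Algebra.smul_def, map_add, map_mul]; ring
    have h2 : π (c • (b y : O)) = π ((c % a) • (b y : O)) := by
      rw [h1, map_add]
      have : π (algebraMap k[X] O a * ((c / a) • (b y : O))) = 0 :=
        Ideal.Quotient.eq_zero_iff_mem.mpr
          (I.mul_mem_right _ (Ideal.mem_span_singleton_self _))
      rw [this, add_zero]
    rw [h2]
    by_cases hd : a.natDegree = 0
    · have : c % a = 0 := by
        rw [EuclideanDomain.mod_eq_zero]
        exact (Polynomial.isUnit_iff_degree_eq_zero.mpr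
          (by rw [Polynomial.degree_eq_natDegree ha, hd]; rfl)).dvd
      simp [this]
    · rw [Polynomial.as_sum_range' (c % a) a.natDegree (Polynomial.natDegree_mod_lt c hd),
        Finset.sum_smul, map_sum]
      refine Submodule.sum_mem _ fun i hi ↦ ?_
      have : (Polynomial.monomial i ((c % a).coeff i) : k[X]) • (b y : O)
          = (c % a).coeff i • ((Polynomial.X ^ i : k[X]) • (b y : O)) := by
        rw [← Polynomial.smul_X_eq_monomial, smul_assoc]
      rw [this, map_smul]
      exact Submodule.smul_mem _ _ (Submodule.subset_span
        ⟨(y, ⟨i, Finset.mem_range.mp hi⟩), rfl⟩)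
  have hN : ∀ y ∈ N, π y ∈ Submodule.span k (Set.range w) := by
    intro y hy
    have := congrArg (Subtype.val) (b.sum_repr ⟨y, hy⟩)
    rw [← show _ = y from this, Submodule.coe_sum, map_sum]
    exact Submodule.sum_mem _ fun i _ ↦ by simpa using hsmul _ i
  have hsub : ∀ z ∈ s, z ∈ Submodule.span k (Set.range w) := by
    intro z hz
    rw [← hg z]
    exact hN _ (Submodule.subset_span (by simpa using ⟨z, hz, rfl⟩))
  have hle : (s : Set (O ⧸ I)) ⊆ Submodule.span k (Set.range w) := hsub
  have hfin : Module.Finite k (Submodule.span k (Set.range w)) :=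
    Module.Finite.span_of_finite _ (Set.finite_range w)
  have h3 : s.card ≤ Module.finrank k (Submodule.span k (Set.range w)) := by
    have hs' : LinearIndependent k
        (fun i : s ↦ (⟨i.1, hsub i.1 i.2⟩ : Submodule.span k (Set.range w))) :=
      LinearIndependent.of_comp (Submodule.subtype _) hs
    simpa using hs'.fintype_card_le_finrank
  have h4 := finrank_range_le_card (R := k) w
  simp only [Set.finrank, Fintype.card_prod, Fintype.card_fin] at h4
  exact h3.trans (h4.trans (Nat.mul_le_mul_right _ hcard))

instance isDedekindDomain_ringOfIntegers : IsDedekindDomain (ringOfIntegers k K) := by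
  let _ : Algebra k (ringOfIntegers k K) :=
    ((algebraMap k[X] (ringOfIntegers k K)).comp Polynomial.C).toAlgebra
  have : IsScalarTower k k[X] (ringOfIntegers k K) := IsScalarTower.of_algebraMap_eq fun _ ↦ rfl
  have hN : IsNoetherianRing (ringOfIntegers k K) := by
    rw [isNoetherianRing_iff_ideal_fg]
    intro J
    by_cases hJ : J = ⊥
    · rw [hJ]; exact Submodule.fg_bot
    obtain ⟨y, hy, hy0⟩ := Submodule.exists_mem_ne_zero_of_ne_bot hJ
    have hint : IsIntegral k[X] y := IsIntegralClosure.isIntegral k[X] K y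
    obtain ⟨a, haJ, ha0⟩ := Submodule.exists_mem_ne_zero_of_ne_bot
      (Ideal.comap_ne_bot_of_integral_mem (R := k[X]) hy0 hy hint)
    have : Module.IsTorsionFree k[X] (ringOfIntegers k K) :=
      Module.isTorsionFree_iff_algebraMap_injective.mpr (ringOfIntegers.algebraMap_injective k K)
    have := finite_quotient_of_rank_le (rank_ringOfIntegers_le k K) a ha0
    set I := Ideal.span {algebraMap k[X] (ringOfIntegers k K) a}
    refine Submodule.fg_of_fg_map_of_fg_inf_ker (Submodule.mkQ I) ?_ ?_
    · have : IsNoetherian (ringOfIntegers k K) (ringOfIntegers k K ⧸ I) :=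
        isNoetherian_of_tower k inferInstance
      exact IsNoetherian.noetherian _
    · rw [Submodule.ker_mkQ, inf_eq_right.mpr
        (show I ≤ J from (Ideal.span_singleton_le_iff_mem _).mpr haJ)]
      exact ⟨{algebraMap k[X] (ringOfIntegers k K) a}, by simp [I, Ideal.span]⟩
  have hD : Ring.DimensionLEOne (ringOfIntegers k K) :=
    Ring.DimensionLEOne.integralClosure k[X] K
  exact { (isDedekindRing_iff (ringOfIntegers k K) K).mpr
    ⟨hN, hD, fun {x} hx ↦ IsIntegrallyClosed.algebraMap_eq_of_integral hx⟩ with }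

end Dedekind

end FunctionField

namespace Infrastructure

universe u

/-! ### Notions that depend only on the infinite places -/

/-- The data attached to the infinite places of `K` from which absolute values and boxes are built:
the set `S` of infinite places, the functions `ν 𝔭` on `K^*` (values at `0` are irrelevant), the
degrees `deg 𝔭`, and the base `q` of the absolute values. It is only used for the two concrete
instances `NF.infinitePlaces` and `FF.infinitePlaces` constructed below. -/
structure InfinitePlaces (K : Type u) where
  /-- the set of infinite places -/
  S : Type u
  /-- the (normalized) valuations on `K^*` -/
  ν : S → K → ℝ
  /-- the degrees of the infinite places -/
  deg : S → ℕ
  /-- the base of the absolute values -/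
  q : ℝ

namespace InfinitePlaces

variable {K : Type u} [Field K] (D : InfinitePlaces K)

open Classical in
/-- `|f|_𝔭 = q ^ (-ν_𝔭(f) deg 𝔭)` for `f ≠ 0`, and `|0|_𝔭 = 0`. -/
def absVal (p : D.S) (f : K) : ℝ :=
  if f = 0 then 0 else D.q ^ (-D.ν p f * D.deg p)

variable {O : Type*} [CommRing O] [Algebra O K]

/-- The box `B(𝔞, t) = {h ∈ 𝔞 | |h|_𝔭 ≤ q ^ (t_𝔭 deg 𝔭) for all 𝔭 ∈ S}`. -/
def box (a : FractionalIdeal O⁰ K) (t : D.S → ℝ) : Set K :=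
  {h | h ∈ a ∧ ∀ p : D.S, D.absVal p h ≤ D.q ^ (t p * D.deg p)}

/-- `μ` is a minimum of `𝔞`: `μ ∈ 𝔞 ∖ {0}`, and every `h` in the box
`B(𝔞, μ) = B(𝔞, (-ν_𝔭(μ))_𝔭)` is zero or has the same infinite absolute values as `μ`. -/
def IsMinimum (a : FractionalIdeal O⁰ K) (μ : K) : Prop :=
  μ ∈ a ∧ μ ≠ 0 ∧
    ∀ h ∈ D.box a (fun p ↦ -D.ν p μ), h = 0 ∨ ∀ p : D.S, D.absVal p h = D.absVal p μ

/-- A fractional ideal is reduced if `1` is one of its minima. -/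
def IsReduced (a : FractionalIdeal O⁰ K) : Prop :=
  D.IsMinimum a 1

/-- `𝔟 ∼ 𝔟'`: there is `h ∈ K^*` with `𝔟 = h 𝔟'` and `|h|_𝔭 = 1` for all `𝔭 ∈ S`. -/
def Equivalent [IsFractionRing O K] (b b' : FractionalIdeal O⁰ K) : Prop :=
  ∃ h : K, h ≠ 0 ∧ b = FractionalIdeal.spanSingleton O⁰ h * b' ∧ ∀ p : D.S, D.absVal p h = 1

end InfinitePlaces

/-- The exponents `n_𝔭` in the factorization `𝔟 = ∏ 𝔭 ^ n_𝔭` of a non-zero fractional ideal of a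
Dedekind domain. -/
def idealExponents {O K : Type*} [CommRing O] [IsDedekindDomain O] [Field K] [Algebra O K]
    [IsFractionRing O K] (b : FractionalIdeal O⁰ K) : HeightOneSpectrum O →₀ ℤ :=
  Finsupp.ofSupportFinite (fun P ↦ FractionalIdeal.count K P b)
    (FractionalIdeal.finite_factors b)

/-! ### Number fields -/

namespace NF

variable (K : Type u) [Field K] [NumberField K]

/-- The archimedean places of a number field, with `ν_𝔭(f) = -log |σ(f)|`, with degree `1` for real
and `2` for complex places, and with `q = e`. -/
def infinitePlaces : InfinitePlaces K where
  S := NumberField.InfinitePlace K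
  ν v f := -Real.log (v f)
  deg v := v.mult
  q := Real.exp 1

/-- The group of divisors of a number field: the free abelian group on the finite places (the
non-zero primes of `𝓞 K`) times `ℝ ^ S`. -/
abbrev Divisor : Type u :=
  (HeightOneSpectrum (𝓞 K) →₀ ℤ) × (NumberField.InfinitePlace K → ℝ)

variable {K}

/-- The degree of a divisor. A finite place `𝔭` has degree `log |𝓞 K / 𝔭|`. -/
def Divisor.degree (D : Divisor K) : ℝ :=
  D.1.sum (fun P n ↦ n * Real.log (Ideal.absNorm P.asIdeal)) +
    ∑ v : NumberField.InfinitePlace K, D.2 v * v.mult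

/-- `div 𝔟 = -∑ n_𝔭 𝔭` for `𝔟 = ∏ 𝔭 ^ n_𝔭`. -/
def idealDivisor (b : FractionalIdeal (𝓞 K)⁰ K) : Divisor K :=
  (-idealExponents b, 0)

end NF

/-! ### Function fields -/

namespace FF

section Place

variable (k K : Type*) [Field k] [Field K] [Algebra k K]

/-- A place of `K / k`, given by its normalized discrete valuation (in multiplicative notation),
i.e. a surjective valuation `K → ℤ ∪ {∞}` that is trivial on `k`. -/
structure Place where
  /-- the normalized valuation, written multiplicatively -/
  val : Valuation K ℤᵐ⁰
  surj : Function.Surjective val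
  trivial : val.IsTrivialOn k

variable {k K}

/-- The normalized discrete valuation `ν_𝔭(f) ∈ ℤ` for `f ≠ 0`. -/
def Place.ord (p : Place k K) (f : K) : ℤ :=
  -WithZero.log (p.val f)

instance (p : Place k K) : Algebra k p.val.valuationSubring :=
  ((algebraMap k K).codRestrict p.val.valuationSubring.toSubring fun c ↦ by
    have := p.trivial
    exact Valuation.IsTrivialOn.valuation_algebraMap_le_one p.val c).toAlgebra

/-- The degree of a place is the degree of its residue field over `k`. -/
def Place.deg (p : Place k K) : ℕ :=
  Module.finrank k (IsLocalRing.ResidueField p.val.valuationSubring)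

variable (k K) in
/-- The group of divisors is the free abelian group on the places. -/
abbrev Divisor : Type _ := Place k K →₀ ℤ

/-- The degree of a divisor. -/
def Divisor.degree (D : Divisor k K) : ℤ :=
  D.sum fun p n ↦ n * (p.deg : ℤ)

end Place

variable (k : Type*) (K : Type u) [Field k] [Field K] [Algebra k K] [Algebra k[X] K]

/-- The infinite places are those where `x` (the image of `X` in `K`) has a pole; they are
the places above the infinite place of `k(x)`. -/
def infinitePlaces (q : ℝ) : InfinitePlaces K where
  S := {p : Place k K // 1 < p.val (algebraMap k[X] K Polynomial.X)}
  ν p f := p.1.ord f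
  deg p := p.1.deg
  q := q

variable [IsScalarTower k k[X] K] [Algebra k⟮X⟯ K] [IsScalarTower k[X] k⟮X⟯ K] [FunctionField k K]

variable {k K}

/-- The finite place that corresponds to a non-zero prime ideal of the integral closure of `k[x]`
in `K`. -/
def finitePlace (P : HeightOneSpectrum (FunctionField.ringOfIntegers k K)) : Place k K where
  val := P.valuation K
  surj := P.valuation_surjective K
  trivial := ⟨fun c hc ↦ by
    have key : ∀ c : k, P.valuation K (algebraMap k K c) ≤ 1 := fun c ↦ by
      rw [IsScalarTower.algebraMap_apply k k[X] K,
        IsScalarTower.algebraMap_apply k[X] (FunctionField.ringOfIntegers k K) K]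
      exact P.valuation_le_one _
    refine le_antisymm (key c) ?_
    have h := key c⁻¹
    have h1 : P.valuation K (algebraMap k K c) * P.valuation K (algebraMap k K c⁻¹) = 1 := by
      rw [← map_mul, ← map_mul, mul_inv_cancel₀ hc, map_one, map_one]
    calc (1 : ℤᵐ⁰) = P.valuation K (algebraMap k K c) * P.valuation K (algebraMap k K c⁻¹) :=
          h1.symm
      _ ≤ P.valuation K (algebraMap k K c) * 1 := mul_le_mul_right h _
      _ = _ := mul_one _⟩

/-- `div 𝔟 = -∑ n_𝔭 𝔭` for `𝔟 = ∏ 𝔭 ^ n_𝔭`. -/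
def idealDivisor (b : FractionalIdeal (FunctionField.ringOfIntegers k K)⁰ K) : Divisor k K :=
  -(idealExponents b).mapDomain finitePlace

end FF

end Infrastructure

end

/-! If `𝔟 = h𝔟'` with `|h| = 1` at every infinite place, then `h` lies in `𝔟𝔟'⁻¹`, and the degrees
agree because such an `h` generates an ideal of degree zero. Conversely, a non-zero `h` in the unit
box of `𝔟𝔟'⁻¹` satisfies `h𝔟' ⊆ 𝔟`. As `1 ∈ 𝔟'`, this puts `h` in `𝔟`, and minimality of `1` in `𝔟`
forces `|h| = 1` at every infinite place. Now `h𝔟'` and `𝔟` have the same degree, and an inclusion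
of ideals of equal degree is an equality (`eq_of_le_of_weightedDegree_eq`).
`InfinitePlaces.equivalent_iff` is this argument; what it needs in each case is the degree-zero
statement.

For number fields that statement follows from the fact that the norm is the product of the infinite
absolute values.

For function fields, write `h = a / b` with `a`, `b` integral; the claim becomes `dim O/a = dim
O/b`. Let `W` be the space of integral functions whose poles at infinity are bounded by those of `x
^ n`, and put `W_c = {z | cz ∈ W}`. For large `n` one has `O = W + abO`, so `dim O/b = dim W_a - dim
W_{ab}`, and likewise with `a` and `b` exchanged. Since `a` and `b` have equal valuations at
infinity, `W_a = W_b`, and the dimensions agree. The work lies in the finite dimension of `W`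
(`finiteDimensional_integersBounded`) and in `O = W + abO` (`exists_sub_mul_mem_integersBounded`).
No separability enters. -/

noncomputable section

namespace Infrastructure

/-! ### Weighted degrees of fractional ideals of a Dedekind domain -/

section Degree

variable {O K : Type*} [CommRing O] [IsDedekindDomain O] [Field K] [Algebra O K]
    [IsFractionRing O K]

/-- The degree `∑ n_𝔭 w_𝔭` of a fractional ideal `∏ 𝔭 ^ n_𝔭` for a family of weights `w`. -/
def weightedDegree (w : HeightOneSpectrum O → ℝ) (b : FractionalIdeal O⁰ K) : ℝ :=
  (idealExponents b).sum fun P n ↦ n * w P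

theorem idealExponents_apply (b : FractionalIdeal O⁰ K) (P : HeightOneSpectrum O) :
    idealExponents b P = FractionalIdeal.count K P b := rfl

theorem idealExponents_mul {b c : FractionalIdeal O⁰ K} (hb : b ≠ 0) (hc : c ≠ 0) :
    idealExponents (b * c) = idealExponents b + idealExponents c := by
  ext P
  simp [idealExponents_apply, FractionalIdeal.count_mul K P hb hc]

variable (w : HeightOneSpectrum O → ℝ)

theorem weightedDegree_mul {b c : FractionalIdeal O⁰ K} (hb : b ≠ 0) (hc : c ≠ 0) :
    weightedDegree w (b * c) = weightedDegree w b + weightedDegree w c := by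
  rw [weightedDegree, idealExponents_mul hb hc]
  exact Finsupp.sum_add_index' (by simp) (by intros; push_cast; ring)

theorem weightedDegree_one : weightedDegree w (1 : FractionalIdeal O⁰ K) = 0 := by
  have := weightedDegree_mul w (K := K) (one_ne_zero (α := FractionalIdeal O⁰ K)) one_ne_zero
  rw [mul_one] at this
  linarith

theorem weightedDegree_inv {b : FractionalIdeal O⁰ K} (hb : b ≠ 0) :
    weightedDegree w b⁻¹ = -weightedDegree w b := by
  have := weightedDegree_mul w hb (inv_ne_zero hb)
  rw [mul_inv_cancel₀ hb, weightedDegree_one] at this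
  linarith

theorem weightedDegree_prime (P : HeightOneSpectrum O) :
    weightedDegree w (P.asIdeal : FractionalIdeal O⁰ K) = w P := by
  have : idealExponents (P.asIdeal : FractionalIdeal O⁰ K) = Finsupp.single P 1 := by
    classical
    ext Q
    rw [idealExponents_apply, FractionalIdeal.count_maximal, Finsupp.single_apply]
  rw [weightedDegree, this, Finsupp.sum_single_index (by simp)]
  simp

/-- Both sides are additive under multiplication by a prime, so induction on the prime factorization
applies. It identifies the degree with `log` of the absolute norm, or with the dimension of the
quotient. -/
theorem weightedDegree_coeIdeal {f : Ideal O → ℝ} (h1 : f 1 = 0)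
    (hf : ∀ (P : HeightOneSpectrum O) (I : Ideal O), I ≠ 0 → f (P.asIdeal * I) = w P + f I)
    {I : Ideal O} (hI : I ≠ 0) : weightedDegree w (I : FractionalIdeal O⁰ K) = f I := by
  induction I using UniqueFactorizationMonoid.induction_on_prime with
  | h₁ => exact absurd rfl hI
  | h₂ J hJ =>
    rw [Ideal.isUnit_iff, ← Ideal.one_eq_top] at hJ
    rw [hJ, h1, Ideal.one_eq_top, FractionalIdeal.coeIdeal_top, weightedDegree_one]
  | h₃ J P hJ hP ih =>
    let Q : HeightOneSpectrum O := ⟨P, Ideal.isPrime_of_prime hP, hP.ne_zero⟩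
    have hQ : w Q + f J = f (P * J) := (hf Q J hJ).symm
    rw [FractionalIdeal.coeIdeal_mul, weightedDegree_mul w
      (FractionalIdeal.coeIdeal_ne_zero.mpr hP.ne_zero) (FractionalIdeal.coeIdeal_ne_zero.mpr hJ),
      ih hJ, ← hQ]
    exact congrArg (· + _) (weightedDegree_prime w Q)

theorem weightedDegree_spanSingleton_div {a b : O} (ha : a ≠ 0) (hb : b ≠ 0) :
    weightedDegree w (FractionalIdeal.spanSingleton O⁰ (algebraMap O K a / algebraMap O K b)) =
      weightedDegree w ((Ideal.span {a} : Ideal O) : FractionalIdeal O⁰ K) -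
        weightedDegree w ((Ideal.span {b} : Ideal O) : FractionalIdeal O⁰ K) := by
  have h : ∀ c : O, c ≠ 0 →
      ((Ideal.span {c} : Ideal O) : FractionalIdeal O⁰ K) ≠ 0 := fun c hc ↦
    FractionalIdeal.coeIdeal_ne_zero.mpr (by simpa using hc)
  rw [sub_eq_add_neg, ← weightedDegree_inv w (h b hb),
    ← weightedDegree_mul w (h a ha) (inv_ne_zero (h b hb)),
    FractionalIdeal.coeIdeal_span_singleton, FractionalIdeal.coeIdeal_span_singleton,
    FractionalIdeal.spanSingleton_inv, FractionalIdeal.spanSingleton_mul_spanSingleton,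
    div_eq_mul_inv]

variable {w}

/-- The inclusion makes every exponent of `b * c⁻¹` non-negative. Their sum with positive weights is
zero, so all of them vanish and `b * c⁻¹ = 1`. -/
theorem eq_of_le_of_weightedDegree_eq (hw : ∀ P, 0 < w P) {b c : FractionalIdeal O⁰ K}
    (hb : b ≠ 0) (h : b ≤ c) (hbc : weightedDegree w b = weightedDegree w c) : b = c := by
  have hc : c ≠ 0 := by
    rintro rfl
    exact hb (FractionalIdeal.le_zero_iff.mp h)
  have hmono := fun P ↦ FractionalIdeal.count_mono K P hb h
  have hd : (idealExponents (b * c⁻¹)).sum (fun P n ↦ (n : ℝ) * w P) = 0 := by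
    change weightedDegree w _ = 0
    rw [weightedDegree_mul w hb (inv_ne_zero hc), weightedDegree_inv w hc, hbc, add_neg_cancel]
  have hnn : ∀ P, 0 ≤ idealExponents (b * c⁻¹) P := fun P ↦ by
    rw [idealExponents_apply, FractionalIdeal.count_mul K P hb (inv_ne_zero hc),
      FractionalIdeal.count_inv]
    linarith [hmono P]
  have hz : ∀ P, FractionalIdeal.count K P (b * c⁻¹) = 0 := by
    intro P
    rw [← idealExponents_apply]
    by_contra hP
    have := (Finset.sum_eq_zero_iff_of_nonneg (fun Q _ ↦
      mul_nonneg (by exact_mod_cast hnn Q) (hw Q).le)).mp hd P (Finsupp.mem_support_iff.mpr hP)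
    rcases mul_eq_zero.mp this with h0 | h0
    · exact hP (by exact_mod_cast h0)
    · exact (hw P).ne' h0
  have h1 := FractionalIdeal.finprod_heightOneSpectrum_factorization' K
    (mul_ne_zero hb (inv_ne_zero hc))
  simp only [hz, zpow_zero, finprod_one] at h1
  exact eq_of_mul_inv_eq_one h1.symm

end Degree

/-! ### The argument common to both cases -/

namespace InfinitePlaces

universe u

variable {K : Type u} [Field K] {D : InfinitePlaces K} {O : Type*} [CommRing O]
    [Algebra O K]

theorem absVal_one (hν : ∀ p, D.ν p 1 = 0) (p : D.S) : D.absVal p 1 = 1 := by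
  simp [absVal, hν]

theorem IsReduced.ne_zero {b : FractionalIdeal O⁰ K} (hb : D.IsReduced b) : b ≠ 0 := by
  rintro rfl
  exact one_ne_zero ((FractionalIdeal.mem_zero_iff O⁰).mp hb.1)

theorem box_ne_singleton_zero_iff (b : FractionalIdeal O⁰ K) :
    D.box b (fun _ ↦ 0) ≠ {0} ↔ ∃ h ∈ b, h ≠ 0 ∧ ∀ p, D.absVal p h ≤ 1 := by
  have h0 : (0 : K) ∈ D.box b (fun _ ↦ 0) := ⟨b.coeToSubmodule.zero_mem, fun p ↦ by simp [absVal]⟩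
  have hbox : ∀ h, h ∈ D.box b (fun _ ↦ 0) ↔ h ∈ b ∧ ∀ p, D.absVal p h ≤ 1 := fun h ↦ by
    simp [box]
  rw [Ne, Set.eq_singleton_iff_unique_mem, not_and]
  constructor
  · intro h
    obtain ⟨x, hx⟩ := not_forall.mp (h h0)
    obtain ⟨hx, hx0⟩ := Classical.not_imp.mp hx
    exact ⟨x, ((hbox x).mp hx).1, hx0, ((hbox x).mp hx).2⟩
  · rintro ⟨x, hx, hx0, hp⟩ _ hall
    exact hx0 (hall x ((hbox x).mpr ⟨hx, hp⟩))

/-- Two reduced ideals are equivalent if and only if `𝔟 𝔟'⁻¹` has a non-zero element in the unit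
box and the degrees agree, provided that elements all of whose infinite absolute values are `1`
generate ideals of degree zero. -/
theorem equivalent_iff [IsDedekindDomain O] [IsFractionRing O K]
    {w : HeightOneSpectrum O → ℝ} (hw : ∀ P, 0 < w P)
    (hν : ∀ p, D.ν p 1 = 0)
    (hprod : ∀ h : K, h ≠ 0 → (∀ p, D.absVal p h = 1) →
      weightedDegree w (FractionalIdeal.spanSingleton O⁰ h) = 0)
    {b b' : FractionalIdeal O⁰ K} (hb : D.IsReduced b) (hb' : D.IsReduced b') :
    D.Equivalent b b' ↔
      D.box (b * b'⁻¹) (fun _ ↦ 0) ≠ {0} ∧ weightedDegree w b = weightedDegree w b' := by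
  have hb0' := hb'.ne_zero
  rw [box_ne_singleton_zero_iff]
  constructor
  · rintro ⟨h, h0, rfl, hp⟩
    have hs : FractionalIdeal.spanSingleton O⁰ h ≠ 0 :=
      FractionalIdeal.spanSingleton_ne_zero_iff.mpr h0
    refine ⟨⟨h, ?_, h0, fun p ↦ (hp p).le⟩, ?_⟩
    · rw [mul_assoc, mul_inv_cancel₀ hb0', mul_one]
      exact FractionalIdeal.mem_spanSingleton_self O⁰ h
    · rw [weightedDegree_mul w hs hb0', hprod h h0 hp, zero_add]
  · rintro ⟨⟨h, hmem, h0, hp⟩, hdeg⟩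
    have hs : FractionalIdeal.spanSingleton O⁰ h ≠ 0 :=
      FractionalIdeal.spanSingleton_ne_zero_iff.mpr h0
    have hle : FractionalIdeal.spanSingleton O⁰ h * b' ≤ b := by
      have := mul_le_mul_left (FractionalIdeal.spanSingleton_le_iff_mem.mpr hmem) b'
      rwa [mul_assoc, inv_mul_cancel₀ hb0', mul_one] at this
    -- This uses `1 ∈ b'`, the membership half of reducedness of `b'`.
    have hhb : h ∈ b := hle (by
      simpa using FractionalIdeal.mul_mem_mul (FractionalIdeal.mem_spanSingleton_self O⁰ h) hb'.1)
    -- Since `ν 1 = 0`, the unit box of `b` is the box that tests minimality of `1`; as `h ≠ 0`, its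
    -- absolute values must be those of `1`.
    have habs : ∀ p, D.absVal p h = 1 := by
      have := hb.2.2 h ⟨hhb, fun p ↦ by simpa [hν] using hp p⟩
      simpa [h0, absVal_one hν] using this
    refine ⟨h, h0, (eq_of_le_of_weightedDegree_eq hw (mul_ne_zero hs hb0') hle ?_).symm, habs⟩
    rw [weightedDegree_mul w hs hb0', hprod h h0 habs, zero_add, hdeg]

end InfinitePlaces

end Infrastructure

/-! ### Number fields: the degree of a principal ideal through the norm -/

namespace Infrastructure.NF

universe u

theorem infinitePlaces_ν_one {K : Type u} [Field K] (v : NumberField.InfinitePlace K) :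
    (infinitePlaces K).ν v 1 = 0 := by
  have : (infinitePlaces K).ν v 1 = -Real.log (v 1) := rfl
  rw [this, map_one, Real.log_one, neg_zero]

variable {K : Type u} [Field K] [NumberField K]

theorem degree_idealDivisor (b : FractionalIdeal (𝓞 K)⁰ K) :
    (idealDivisor b).degree =
      -weightedDegree (fun P ↦ Real.log (Ideal.absNorm P.asIdeal)) b := by
  simp [Divisor.degree, idealDivisor, weightedDegree, Finsupp.sum]

theorem weightedDegree_eq_log_absNorm {I : Ideal (𝓞 K)} (hI : I ≠ 0) :
    weightedDegree (fun P ↦ Real.log (Ideal.absNorm P.asIdeal))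
      (I : FractionalIdeal (𝓞 K)⁰ K) = Real.log (Ideal.absNorm I) := by
  refine weightedDegree_coeIdeal _ (f := fun I ↦ Real.log (Ideal.absNorm I)) (by simp) ?_ hI
  intro P I hI
  rw [map_mul, Nat.cast_mul, Real.log_mul]
  · exact_mod_cast Ideal.absNorm_eq_zero_iff.not.mpr P.ne_bot
  · exact_mod_cast Ideal.absNorm_eq_zero_iff.not.mpr hI

theorem log_absNorm_pos (P : HeightOneSpectrum (𝓞 K)) :
    0 < Real.log (Ideal.absNorm P.asIdeal) := by
  refine Real.log_pos ?_
  have h0 := Ideal.absNorm_eq_zero_iff.not.mpr P.ne_bot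
  have h1 := Ideal.absNorm_eq_one_iff.not.mpr P.isPrime.ne_top
  exact_mod_cast (by omega : 1 < Ideal.absNorm P.asIdeal)

theorem weightedDegree_span (a : 𝓞 K) (ha : a ≠ 0) :
    weightedDegree (fun P ↦ Real.log (Ideal.absNorm P.asIdeal))
      ((Ideal.span {a} : Ideal (𝓞 K)) : FractionalIdeal (𝓞 K)⁰ K) =
      Real.log |(Algebra.norm ℚ (a : K) : ℝ)| := by
  rw [weightedDegree_eq_log_absNorm (by simpa using ha), Ideal.absNorm_span_singleton,
    ← Algebra.coe_norm_int, Nat.cast_natAbs]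
  norm_num

theorem weightedDegree_spanSingleton {h : K} (h0 : h ≠ 0)
    (hp : ∀ p, (infinitePlaces K).absVal p h = 1) :
    weightedDegree (fun P ↦ Real.log (Ideal.absNorm P.asIdeal))
      (FractionalIdeal.spanSingleton (𝓞 K)⁰ h) = 0 := by
  have hv : ∀ v : NumberField.InfinitePlace K, v h ^ v.mult = 1 := by
    intro v
    have hpos : 0 < v h := NumberField.InfinitePlace.pos_iff.mpr h0
    have h1 := hp v
    -- With `q = e`, `absVal` is `v h ^ mult`, exactly the factor at `v` in the product formula for
    -- the norm.
    simp only [InfinitePlaces.absVal, if_neg h0, infinitePlaces, neg_neg, Real.exp_one_rpow] at h1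
    rwa [Real.exp_mul, Real.exp_log hpos, Real.rpow_natCast] at h1
  have hN : |(Algebra.norm ℚ h : ℝ)| = 1 := by
    have := NumberField.InfinitePlace.prod_eq_abs_norm h
    simp only [hv, Finset.prod_const_one] at this
    exact_mod_cast this.symm
  obtain ⟨a, b, hb, rfl⟩ := IsFractionRing.div_surjective (A := 𝓞 K) h
  have hb0 : b ≠ 0 := nonZeroDivisors.ne_zero hb
  have ha0 : a ≠ 0 := by
    rintro rfl
    simp at h0
  rw [weightedDegree_spanSingleton_div _ ha0 hb0, weightedDegree_span a ha0,
    weightedDegree_span b hb0, sub_eq_zero]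
  have hmul : Algebra.norm ℚ (algebraMap (𝓞 K) K a / algebraMap (𝓞 K) K b) *
      Algebra.norm ℚ (algebraMap (𝓞 K) K b) = Algebra.norm ℚ (algebraMap (𝓞 K) K a) := by
    rw [← map_mul, div_mul_cancel₀ _ (by simpa using hb0)]
  rw [← hmul, Rat.cast_mul, abs_mul, hN, one_mul]

theorem equivalent_iff {b b' : FractionalIdeal (𝓞 K)⁰ K} (hb : (infinitePlaces K).IsReduced b)
    (hb' : (infinitePlaces K).IsReduced b') :
    (infinitePlaces K).Equivalent b b' ↔
      (infinitePlaces K).box (b * b'⁻¹) (fun _ ↦ 0) ≠ {0} ∧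
        (idealDivisor b).degree = (idealDivisor b').degree := by
  rw [degree_idealDivisor, degree_idealDivisor, neg_inj]
  exact InfinitePlaces.equivalent_iff log_absNorm_pos infinitePlaces_ν_one
    (fun _ ↦ weightedDegree_spanSingleton) hb hb'

end Infrastructure.NF

namespace Infrastructure

/-! ### Dimensions of quotients by ideals -/

section FiniteQuotients

variable {k O : Type*} [Field k] [CommRing O] [Algebra k O]

/-- With `W_a = {x | a x ∈ W}`, the map `W_a → O / b` is onto with kernel `b W_{ab}`. -/
theorem finrank_quotient_add_finrank_comap [IsDomain O] {W : Submodule k O} [FiniteDimensional k W]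
    {a b : O} (ha : a ≠ 0) (hb : b ≠ 0) (hs : ∀ x, ∃ g, x - a * b * g ∈ W) :
    Module.finrank k (O ⧸ Ideal.span {b}) +
      Module.finrank k (W.comap (LinearMap.mulLeft k (a * b))) =
      Module.finrank k (W.comap (LinearMap.mulLeft k a)) := by
  have hinj : ∀ c : O, c ≠ 0 → Function.Injective (LinearMap.mulLeft k c) := fun c hc ↦
    mul_right_injective₀ hc
  have hfin : FiniteDimensional k (W.comap (LinearMap.mulLeft k a)) :=
    Module.Finite.of_injective
      ((LinearMap.mulLeft k a).restrict (p := W.comap (LinearMap.mulLeft k a)) (q := W)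
        fun x hx ↦ hx)
      fun x y hxy ↦ Subtype.ext (hinj a ha (congrArg Subtype.val hxy))
  let π : W.comap (LinearMap.mulLeft k a) →ₗ[k] O ⧸ Ideal.span {b} :=
    (Ideal.Quotient.mkₐ k (Ideal.span {b})).toLinearMap ∘ₗ Submodule.subtype _
  have hπ : LinearMap.range π = ⊤ := by
    rw [LinearMap.range_eq_top]
    intro z
    obtain ⟨x, rfl⟩ := Ideal.Quotient.mk_surjective z
    obtain ⟨g, hg⟩ := hs (a * x)
    refine ⟨⟨x - b * g, ?_⟩, ?_⟩
    · rw [Submodule.mem_comap, LinearMap.mulLeft_apply]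
      convert hg using 1
      ring
    · change Ideal.Quotient.mk _ (x - b * g) = _
      rw [Ideal.Quotient.mk_eq_mk_iff_sub_mem]
      rw [sub_sub_cancel_left]
      exact neg_mem (Ideal.mul_mem_right _ _ (Ideal.mem_span_singleton_self b))
  let ψ : W.comap (LinearMap.mulLeft k (a * b)) →ₗ[k] W.comap (LinearMap.mulLeft k a) :=
    (LinearMap.mulLeft k b).restrict fun x hx ↦ by
      simpa [mul_assoc] using hx
  have hψ : Function.Injective ψ := fun x y hxy ↦
    Subtype.ext (hinj b hb (congrArg Subtype.val hxy))
  have hker : LinearMap.ker π = LinearMap.range ψ := by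
    ext ⟨x, hx⟩
    rw [LinearMap.mem_ker]
    change Ideal.Quotient.mk _ x = 0 ↔ _
    rw [Ideal.Quotient.eq_zero_iff_mem, Ideal.mem_span_singleton']
    constructor
    · rintro ⟨c, rfl⟩
      refine ⟨⟨c, ?_⟩, Subtype.ext (mul_comm _ _)⟩
      rw [Submodule.mem_comap, LinearMap.mulLeft_apply] at hx ⊢
      rwa [mul_assoc, mul_comm b]
    · rintro ⟨c, hc⟩
      exact ⟨c, (mul_comm _ _).trans (congrArg Subtype.val hc)⟩
  rw [← LinearMap.finrank_range_add_finrank_ker π, hπ, hker, finrank_top,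
    LinearMap.finrank_range_of_inj hψ]

/-- The preceding formula, applied to `(a, b)` and to `(b, a)`, has the same term `W_{ab}`, and `hW`
says `W_a = W_b`. -/
theorem finrank_quotient_span_eq [IsDomain O] {W : Submodule k O} [FiniteDimensional k W]
    {a b : O} (ha : a ≠ 0) (hb : b ≠ 0) (hW : ∀ x, a * x ∈ W ↔ b * x ∈ W)
    (hs : ∀ x, ∃ g, x - a * b * g ∈ W) :
    Module.finrank k (O ⧸ Ideal.span {a}) = Module.finrank k (O ⧸ Ideal.span {b}) := by
  have h1 := finrank_quotient_add_finrank_comap ha hb hs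
  have h2 := finrank_quotient_add_finrank_comap (W := W) hb ha (by simpa [mul_comm b a] using hs)
  have h3 : W.comap (LinearMap.mulLeft k a) = W.comap (LinearMap.mulLeft k b) := by
    ext x
    exact hW x
  rw [h3] at h1
  rw [mul_comm b a] at h2
  omega

/-- The kernel of `O/IJ → O/J` is `J/IJ`. Choosing `t` with `IJ + (t) = J`, multiplication by `t`
induces an isomorphism from `O/I` onto it. -/
theorem finrank_quotient_mul [IsDedekindDomain O] {I J : Ideal O} (hI : I ≠ 0) (hJ : J ≠ 0)
    (hfin : FiniteDimensional k (O ⧸ (I * J))) :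
    Module.finrank k (O ⧸ (I * J)) = Module.finrank k (O ⧸ I) + Module.finrank k (O ⧸ J) := by
  obtain ⟨t, ht⟩ := IsDedekindDomain.exists_sup_span_eq (Ideal.mul_le_right : I * J ≤ J)
    (mul_ne_zero hI hJ)
  let φ : (O ⧸ (I * J)) →ₗ[k] O ⧸ J := (Ideal.Quotient.factorₐ k Ideal.mul_le_right).toLinearMap
  have hφ : LinearMap.range φ = ⊤ :=
    LinearMap.range_eq_top.mpr (Ideal.Quotient.factor_surjective Ideal.mul_le_right)
  let ψ : O →ₗ[k] O ⧸ (I * J) :=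
    (Ideal.Quotient.mkₐ k (I * J)).toLinearMap ∘ₗ LinearMap.mulLeft k t
  have htJ : t ∈ J := by
    rw [← ht]
    exact Ideal.mem_sup_right (Ideal.mem_span_singleton_self t)
  have hkerψ : LinearMap.ker ψ = I.restrictScalars k := by
    ext r
    rw [LinearMap.mem_ker, Submodule.restrictScalars_mem]
    change Ideal.Quotient.mk _ (t * r) = 0 ↔ _
    rw [Ideal.Quotient.eq_zero_iff_mem]
    refine ⟨fun h ↦ ?_, fun h ↦ by rw [mul_comm t r]; exact Ideal.mul_mem_mul h htJ⟩
    -- From `tr ∈ IJ` and `J = IJ + (t)` one gets `rJ ⊆ IJ`; cancelling `J` gives `r ∈ I`.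
    have : Ideal.span {r} * J ≤ I * J := by
      nth_rw 1 [← ht]
      rw [Ideal.mul_sup, Ideal.span_singleton_mul_span_singleton, sup_le_iff]
      refine ⟨Ideal.mul_le_right, ?_⟩
      rwa [Ideal.span_singleton_le_iff_mem, mul_comm r t]
    rwa [← Ideal.dvd_iff_le, mul_dvd_mul_iff_right hJ, Ideal.dvd_iff_le,
      Ideal.span_singleton_le_iff_mem] at this
  have hrange : LinearMap.range ψ = LinearMap.ker φ := by
    ext z
    obtain ⟨z, rfl⟩ := Ideal.Quotient.mk_surjective z
    rw [LinearMap.mem_ker]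
    change _ ↔ Ideal.Quotient.mk J z = 0
    have hz : z ∈ J ↔ z ∈ I * J ⊔ Ideal.span {t} := by rw [ht]
    rw [Ideal.Quotient.eq_zero_iff_mem, hz, Submodule.mem_sup]
    constructor
    · rintro ⟨r, hr⟩
      refine ⟨z - t * r, Ideal.Quotient.eq.mp hr.symm, t * r, ?_, by ring⟩
      exact Ideal.mul_mem_right _ _ (Ideal.mem_span_singleton_self t)
    · rintro ⟨c, hc, d, hd, rfl⟩
      obtain ⟨r, rfl⟩ := Ideal.mem_span_singleton'.mp hd
      refine ⟨r, Ideal.Quotient.eq.mpr ?_⟩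
      rw [LinearMap.mulLeft_apply, show t * r - (c + r * t) = -c by ring]
      exact neg_mem hc
  rw [← LinearMap.finrank_range_add_finrank_ker φ, hφ, finrank_top, ← hrange,
    ← (LinearMap.quotKerEquivRange ψ).finrank_eq, hkerψ, add_comm]
  rfl

end FiniteQuotients

end Infrastructure

namespace Infrastructure.FF

/-! ### Residue field of a place with given centre -/

section ResidueField

variable {k K O : Type*} [Field k] [Field K] [Algebra k K] [CommRing O]
    [IsDedekindDomain O] [Algebra O K] [IsFractionRing O K] [Algebra k O] [IsScalarTower k O K]

/-- If the place `p` has the centre `P` on the Dedekind domain `O`, then its residue field is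
`O / P`. -/
theorem residueField_of_center (p : Place k K) (P : HeightOneSpectrum O)
    (h1 : ∀ a : O, p.val (algebraMap O K a) ≤ 1)
    (hP : ∀ a : O, p.val (algebraMap O K a) < 1 ↔ a ∈ P.asIdeal) :
    Nonempty ((O ⧸ P.asIdeal) ≃ₗ[k] IsLocalRing.ResidueField p.val.valuationSubring) := by
  let ι : O →ₗ[k] p.val.valuationSubring :=
    { toFun := fun a ↦ ⟨algebraMap O K a, h1 a⟩
      map_add' := fun a b ↦ Subtype.ext (map_add _ a b)
      map_smul' := fun c a ↦ Subtype.ext (by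
        change algebraMap O K (c • a) = algebraMap k K c * algebraMap O K a
        rw [Algebra.smul_def, map_mul, ← IsScalarTower.algebraMap_apply]) }
  let π : O →ₗ[k] IsLocalRing.ResidueField p.val.valuationSubring :=
    (IsScalarTower.toAlgHom k p.val.valuationSubring _).toLinearMap ∘ₗ ι
  have hπ0 : ∀ z : p.val.valuationSubring,
      IsLocalRing.residue p.val.valuationSubring z = 0 ↔ p.val (z : K) < 1 := fun z ↦ by
    rw [IsLocalRing.residue_eq_zero_iff]
    exact p.val.mem_maximalIdeal_iff
  have hker : LinearMap.ker π = P.asIdeal.restrictScalars k := by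
    ext a
    rw [LinearMap.mem_ker, Submodule.restrictScalars_mem, ← hP]
    exact hπ0 (ι a)
  have hfrac : ∀ f : K, p.val f ≤ 1 →
      ∃ a s : O, s ∉ P.asIdeal ∧ f * algebraMap O K s = algebraMap O K a := by
    intro f hf
    obtain ⟨n, d, h | h⟩ := P.exists_primeCompl_mul_eq_or_mul_eq (K := K) f
    · exact ⟨n, d, d.2, h⟩
    -- Here `f * n = d` with `d` a unit at `p`; as `f` is regular at `p`, the factor `n` cannot lie
    -- in `P`.
    · refine ⟨d, n, fun hn ↦ ?_, h⟩
      have hd : ¬ p.val (algebraMap O K d) < 1 := fun h ↦ d.2 ((hP _).mp h)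
      rw [← h, map_mul] at hd
      exact hd (mul_lt_one_of_nonneg_of_lt_one_right hf zero_le ((hP n).mpr hn))
  have hsurj : Function.Surjective π := by
    intro z
    obtain ⟨⟨f, hf⟩, rfl⟩ := IsLocalRing.residue_surjective z
    obtain ⟨a, s, hs, hfs⟩ := hfrac f hf
    -- With `us + i = 1` and `i ∈ P`, the integral element `ua = usf` differs from `f` by `-if`,
    -- which vanishes at `p`.
    obtain ⟨u, i, hi, hu⟩ := P.isMaximal.exists_inv hs
    refine ⟨u * a, ?_⟩
    rw [← sub_eq_zero]
    change IsLocalRing.residue _ (ι (u * a)) - IsLocalRing.residue _ _ = 0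
    rw [← map_sub, hπ0]
    have : algebraMap O K (u * a) - f = -(algebraMap O K i * f) := by
      have h1 : algebraMap O K u * algebraMap O K s + algebraMap O K i = 1 := by
        rw [← map_mul, ← map_add, hu, map_one]
      rw [map_mul, ← hfs]
      linear_combination f * h1
    change p.val (algebraMap O K (u * a) - f) < 1
    rw [this, Valuation.map_neg, map_mul]
    exact mul_lt_one_of_nonneg_of_lt_one_left zero_le ((hP i).mpr hi) hf
  exact ⟨(Submodule.quotEquivOfEq _ _ hker.symm).trans (π.quotKerEquivOfSurjective hsurj)⟩

theorem deg_eq_of_center (p : Place k K) (P : HeightOneSpectrum O)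
    (h1 : ∀ a : O, p.val (algebraMap O K a) ≤ 1)
    (hP : ∀ a : O, p.val (algebraMap O K a) < 1 ↔ a ∈ P.asIdeal) :
    p.deg = Module.finrank k (O ⧸ P.asIdeal) := by
  obtain ⟨e⟩ := residueField_of_center p P h1 hP
  exact e.finrank_eq.symm

end ResidueField

/-! ### Functions bounded at the zeros of a given function -/

section Bounded

variable (k : Type*) {K : Type*} [Field k] [Field K] [Algebra k K]

/-- The functions whose values at the zeros of `y` are bounded by those of `t`. -/
def boundedAtZeros (y t : K) : Submodule k K where
  carrier := {f | ∀ p : Place k K, p.val y < 1 → p.val f ≤ p.val t}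
  add_mem' hf hg p hp := p.val.map_add_le (hf p hp) (hg p hp)
  zero_mem' p _ := by simp
  smul_mem' c f hf p hp := by
    have := p.trivial
    rw [Algebra.smul_def, map_mul]
    exact mul_le_of_le_one_left' (Valuation.IsTrivialOn.valuation_algebraMap_le_one p.val c)
      |>.trans (hf p hp)

variable {k}

theorem mul_mem_boundedAtZeros {y t t' f g : K} (hf : f ∈ boundedAtZeros k y t)
    (hg : g ∈ boundedAtZeros k y t') : f * g ∈ boundedAtZeros k y (t * t') := fun p hp ↦ by
  rw [map_mul, map_mul]
  exact mul_le_mul' (hf p hp) (hg p hp)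

theorem self_mem_boundedAtZeros (y t : K) : t ∈ boundedAtZeros k y t := fun _ _ ↦ le_rfl

end Bounded

/-- A monic equation with coefficients in the image of `φ` is one over the valuation ring.
Integrality is phrased through a ring homomorphism so that it covers `k[1/x]` as well as `k[x]`. -/
theorem isIntegral_valuationSubring {F L R Γ : Type*} [Field F] [Field L] [Algebra F L]
    [CommRing R] [LinearOrderedCommGroupWithZero Γ] (v : Valuation F Γ) (φ : R →+* F)
    (hφ : ∀ r, v (φ r) ≤ 1) {f : L} (hf : ((algebraMap F L).comp φ).IsIntegralElem f) :
    IsIntegral v.valuationSubring f := by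
  obtain ⟨g, hg, hgf⟩ := hf
  let ρ : R →+* v.valuationSubring := φ.codRestrict v.valuationSubring.toSubring hφ
  refine ⟨g.map ρ, hg.map ρ, ?_⟩
  rw [Polynomial.eval₂_map]
  exact hgf

theorem valuation_le_one_of_isIntegralElem {F R Γ : Type*} [Field F]
    [CommRing R] [LinearOrderedCommGroupWithZero Γ] (v : Valuation F Γ) (φ : R →+* F)
    (hφ : ∀ r, v (φ r) ≤ 1) {f : F} (hf : φ.IsIntegralElem f) : v f ≤ 1 := by
  obtain ⟨z, rfl⟩ := IsIntegrallyClosed.isIntegral_iff.mp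
    (isIntegral_valuationSubring (L := F) v φ hφ hf)
  exact z.2

/-! ### Local theory at the zeros of `x` -/

section Zeros

variable {k K : Type*} [Field k] [Field K] [Algebra k K] [Algebra k[X] K] [IsScalarTower k k[X] K]

theorem Place.val_algebraMap_polynomial_le_one (p : Place k K)
    (hp : p.val (algebraMap k[X] K Polynomial.X) ≤ 1) (g : k[X]) :
    p.val (algebraMap k[X] K g) ≤ 1 := by
  have := p.trivial
  induction g using Polynomial.induction_on' with
  | add g h hg hh => rw [map_add]; exact p.val.map_add_le hg hh
  | monomial n c =>
    rw [← Polynomial.C_mul_X_pow_eq_monomial, map_mul, map_mul, map_pow, map_pow,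
      ← Polynomial.algebraMap_eq, ← IsScalarTower.algebraMap_apply]
    exact mul_le_one' (Valuation.IsTrivialOn.valuation_algebraMap_le_one p.val c)
      (pow_le_one' hp n)

theorem Place.val_le_one_of_isIntegral (p : Place k K)
    (hp : p.val (algebraMap k[X] K Polynomial.X) ≤ 1) {f : K} (hf : IsIntegral k[X] f) :
    p.val f ≤ 1 :=
  valuation_le_one_of_isIntegralElem p.val _ (p.val_algebraMap_polynomial_le_one hp) hf

variable [Algebra k⟮X⟯ K] [IsScalarTower k[X] k⟮X⟯ K] [FunctionField k K]

open FunctionField (ringOfIntegers)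

theorem finitePlace_val_X_lt_one_iff (P : HeightOneSpectrum (ringOfIntegers k K)) :
    (finitePlace P).val (algebraMap k[X] K Polynomial.X) < 1 ↔
      algebraMap k[X] (ringOfIntegers k K) Polynomial.X ∈ P.asIdeal :=
  P.valuation_lt_one_iff_mem (K := K) (algebraMap k[X] (ringOfIntegers k K) Polynomial.X)

/-- The denominator ideal of `f` contains a polynomial not divisible by `X`. Otherwise some prime
above `(X)` would contain that ideal, although `f` is regular at the corresponding place. -/
theorem exists_isIntegral_mul {f : K}
    (hf : f ∈ boundedAtZeros k (algebraMap k[X] K Polynomial.X) 1) :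
    ∃ s : k[X], s.coeff 0 ≠ 0 ∧ IsIntegral k[X] (algebraMap k[X] K s * f) := by
  obtain ⟨a, b, hb, rfl⟩ := IsFractionRing.div_surjective (A := ringOfIntegers k K) f
  have hb0 : algebraMap (ringOfIntegers k K) K b ≠ 0 := by
    simpa using nonZeroDivisors.ne_zero hb
  let I : Ideal (ringOfIntegers k K) :=
    Submodule.comap (LinearMap.mulLeft (ringOfIntegers k K) a) (Ideal.span {b})
  have hI : ∀ s, s ∈ I ↔ a * s ∈ Ideal.span {b} := fun s ↦ Iff.rfl
  have hle : ¬ I.comap (algebraMap k[X] (ringOfIntegers k K)) ≤ Ideal.span {Polynomial.X} := by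
    intro hle
    have : (Ideal.span {Polynomial.X} : Ideal k[X]).IsPrime :=
      (Ideal.span_singleton_prime Polynomial.X_ne_zero).mpr Polynomial.prime_X
    have : Algebra.IsIntegral k[X] (ringOfIntegers k K) :=
      IsIntegralClosure.isIntegral_algebra k[X] K
    obtain ⟨Q, hIQ, hQ, hQX⟩ := Ideal.exists_ideal_over_prime_of_isIntegral _ I hle
    have hX : algebraMap k[X] (ringOfIntegers k K) Polynomial.X ∈ Q := by
      rw [← Ideal.mem_comap, hQX]
      exact Ideal.mem_span_singleton_self _
    let P : HeightOneSpectrum (ringOfIntegers k K) := ⟨Q, hQ, by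
      rintro rfl
      rw [Ideal.mem_bot] at hX
      exact Polynomial.X_ne_zero (FunctionField.ringOfIntegers.algebraMap_injective k K
        (hX.trans (map_zero _).symm))⟩
    have h1 := hf (finitePlace P) ((finitePlace_val_X_lt_one_iff P).mpr hX)
    rw [map_one] at h1
    -- Regularity at `P` gives a denominator `d ∉ P` of `f`, which lies in `I ≤ P`: a contradiction.
    obtain ⟨n, d, hnd⟩ := P.exists_primeCompl_mul_eq_of_integer (K := K) _ h1
    refine d.2 (hIQ ((hI _).mpr (Ideal.mem_span_singleton'.mpr ⟨n, ?_⟩)))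
    apply IsFractionRing.injective (ringOfIntegers k K) K
    rw [map_mul, map_mul, ← hnd]
    field_simp
  obtain ⟨s, hs, hsX⟩ := Set.not_subset.mp hle
  refine ⟨s, fun h ↦ hsX (Ideal.mem_span_singleton.mpr (Polynomial.X_dvd_iff.mpr h)), ?_⟩
  obtain ⟨c, hc⟩ := Ideal.mem_span_singleton'.mp ((hI _).mp hs)
  have hc' := congrArg (algebraMap (ringOfIntegers k K) K) hc
  rw [map_mul, map_mul, ← IsScalarTower.algebraMap_apply] at hc'
  have : algebraMap k[X] K s * (algebraMap (ringOfIntegers k K) K a /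
      algebraMap (ringOfIntegers k K) K b) = algebraMap (ringOfIntegers k K) K c := by
    rw [← mul_div_assoc, div_eq_iff hb0, hc', mul_comm]
  rw [this]
  exact c.2

theorem finiteDimensional_quotient_span {a : ringOfIntegers k K} (ha : a ≠ 0) :
    FiniteDimensional k (ringOfIntegers k K ⧸ Ideal.span {a}) := by
  have hint : IsIntegral k[X] a := IsIntegralClosure.isIntegral k[X] K a
  obtain ⟨c, hc, hc0⟩ := Submodule.exists_mem_ne_zero_of_ne_bot
    (Ideal.comap_ne_bot_of_integral_mem (R := k[X]) ha (Ideal.mem_span_singleton_self a) hint)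
  have : Module.IsTorsionFree k[X] (ringOfIntegers k K) :=
    Module.isTorsionFree_iff_algebraMap_injective.mpr
      (FunctionField.ringOfIntegers.algebraMap_injective k K)
  have := FunctionField.finite_quotient_of_rank_le
    (FunctionField.rank_ringOfIntegers_le k K) c hc0
  have hle : Ideal.span {algebraMap k[X] (ringOfIntegers k K) c} ≤ Ideal.span {a} :=
    (Ideal.span_singleton_le_iff_mem _).mpr hc
  exact Module.Finite.of_surjective (Ideal.Quotient.factorₐ k hle).toLinearMap
    (Ideal.Quotient.factor_surjective hle)

theorem finiteDimensional_quotient {I : Ideal (ringOfIntegers k K)} (hI : I ≠ ⊥) :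
    FiniteDimensional k (ringOfIntegers k K ⧸ I) := by
  obtain ⟨a, ha, ha0⟩ := Submodule.exists_mem_ne_zero_of_ne_bot hI
  have := finiteDimensional_quotient_span ha0
  have hle : Ideal.span {a} ≤ I := (Ideal.span_singleton_le_iff_mem _).mpr ha
  exact Module.Finite.of_surjective (Ideal.Quotient.factorₐ k hle).toLinearMap
    (Ideal.Quotient.factor_surjective hle)

theorem finrank_quotient_pos (P : HeightOneSpectrum (ringOfIntegers k K)) :
    0 < Module.finrank k (ringOfIntegers k K ⧸ P.asIdeal) := by
  have := finiteDimensional_quotient P.ne_bot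
  have := Ideal.Quotient.nontrivial_iff.mpr P.isPrime.ne_top
  exact Module.finrank_pos

theorem deg_finitePlace (P : HeightOneSpectrum (ringOfIntegers k K)) :
    (finitePlace P).deg = Module.finrank k (ringOfIntegers k K ⧸ P.asIdeal) :=
  deg_eq_of_center _ P (P.valuation_le_one (K := K)) (P.valuation_lt_one_iff_mem (K := K))

/-- The centre of `p` on the ring of integers is a prime `P` containing `X`, hence non-zero, so the
residue field is `O/P`, of finite positive dimension. Thus the degree is not the default value `0`
of `finrank`. -/
theorem Place.deg_pos_of_val_X_lt_one (p : Place k K)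
    (hp : p.val (algebraMap k[X] K Polynomial.X) < 1) : 0 < p.deg := by
  have h1 : ∀ a : ringOfIntegers k K, p.val (algebraMap (ringOfIntegers k K) K a) ≤ 1 :=
    fun a ↦ p.val_le_one_of_isIntegral hp.le a.2
  let Q : Ideal (ringOfIntegers k K) :=
    { carrier := {a | p.val (algebraMap (ringOfIntegers k K) K a) < 1}
      add_mem' := fun {a b} ha hb ↦ by
        rw [Set.mem_ofPred_eq, map_add]
        exact p.val.map_add_lt ha hb
      zero_mem' := by simp
      smul_mem' := fun c a ha ↦ by
        rw [Set.mem_ofPred_eq, smul_eq_mul, map_mul, map_mul]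
        exact mul_lt_one_of_nonneg_of_lt_one_right (h1 c) zero_le ha }
  have hQ : ∀ a, a ∈ Q ↔ p.val (algebraMap (ringOfIntegers k K) K a) < 1 := fun a ↦ Iff.rfl
  let P : HeightOneSpectrum (ringOfIntegers k K) :=
    { asIdeal := Q
      isPrime := by
        refine Ideal.isPrime_iff.mpr ⟨?_, fun {a b} hab ↦ ?_⟩
        · rw [Ne, Ideal.eq_top_iff_one, hQ]
          simp
        · rw [hQ, map_mul, map_mul] at hab
          rw [hQ, hQ]
          by_contra! h
          exact hab.not_ge (one_le_mul h.1 h.2)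
      ne_bot := by
        intro h
        have hX : algebraMap k[X] (ringOfIntegers k K) Polynomial.X ∈ Q := hp
        rw [h, Ideal.mem_bot] at hX
        exact Polynomial.X_ne_zero (FunctionField.ringOfIntegers.algebraMap_injective k K
          (hX.trans (map_zero _).symm)) }
  rw [deg_eq_of_center p P h1 fun a ↦ Iff.rfl]
  exact finrank_quotient_pos P

/-- The finite-dimensional quotient of the ring of integers by `X ^ n` already covers this space:
modulo functions vanishing to the order of `X ^ n`, every regular function is integral. -/
theorem finiteDimensional_map_mkQ_boundedAtZeros (n : ℕ) :
    FiniteDimensional k ((boundedAtZeros k (algebraMap k[X] K Polynomial.X) 1).map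
      (boundedAtZeros k (algebraMap k[X] K Polynomial.X)
        (algebraMap k[X] K Polynomial.X ^ n)).mkQ) := by
  set y := algebraMap k[X] K Polynomial.X with hy
  have hO : ∀ f : K, IsIntegral k[X] f → f ∈ boundedAtZeros k y 1 := fun f hf p hp ↦ by
    rw [map_one]
    exact p.val_le_one_of_isIntegral hp.le hf
  let ι : ringOfIntegers k K →ₗ[k] K :=
    (IsScalarTower.toAlgHom k (ringOfIntegers k K) K).toLinearMap
  have hι : ∀ a, ι a = algebraMap (ringOfIntegers k K) K a := fun a ↦ rfl
  let I : Ideal (ringOfIntegers k K) :=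
    Ideal.span {algebraMap k[X] (ringOfIntegers k K) (Polynomial.X ^ n)}
  have hI : I ≠ ⊥ := by
    rw [Ne, Ideal.span_singleton_eq_bot,
      map_eq_zero_iff _ (FunctionField.ringOfIntegers.algebraMap_injective k K)]
    exact pow_ne_zero _ Polynomial.X_ne_zero
  have := finiteDimensional_quotient hI
  let π : (ringOfIntegers k K ⧸ I) →ₗ[k] K ⧸ boundedAtZeros k y (y ^ n) :=
    Submodule.mapQ (I.restrictScalars k) _ ι fun a ha ↦ by
      obtain ⟨c, rfl⟩ := Ideal.mem_span_singleton'.mp ha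
      have := mul_mem_boundedAtZeros (hO c c.2) (self_mem_boundedAtZeros (k := k) y (y ^ n))
      rw [one_mul] at this
      have e : ι (c * algebraMap k[X] (ringOfIntegers k K) (Polynomial.X ^ n)) = c * y ^ n := by
        rw [hι, map_mul, ← IsScalarTower.algebraMap_apply, map_pow]
        rfl
      change ι _ ∈ boundedAtZeros k y (y ^ n)
      rwa [e]
  refine Submodule.finiteDimensional_of_le (S₂ := LinearMap.range π) ?_
  rintro _ ⟨f, hf, rfl⟩
  obtain ⟨s, hs0, hs⟩ := exists_isIntegral_mul hf
  have hcop : IsCoprime s (Polynomial.X ^ n) := by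
    refine IsCoprime.pow_right (IsCoprime.symm ?_)
    refine (Polynomial.irreducible_X.coprime_iff_not_dvd).mpr ?_
    rwa [Polynomial.X_dvd_iff]
  -- Since `us + wX ^ n = 1`, the integral element `usf` differs from `f` by `wfX ^ n`.
  obtain ⟨u, w, huw⟩ := hcop
  let g : ringOfIntegers k K := ⟨algebraMap k[X] K u * (algebraMap k[X] K s * f),
    IsIntegral.mul isIntegral_algebraMap hs⟩
  refine ⟨Submodule.Quotient.mk g, ?_⟩
  change Submodule.Quotient.mk (ι g) = Submodule.Quotient.mk f
  rw [eq_comm, Submodule.Quotient.eq]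
  have h1 : f - ι g = (algebraMap k[X] K w * f) * y ^ n := by
    have := congrArg (algebraMap k[X] K) huw
    rw [map_add, map_mul, map_mul, map_pow, map_one] at this
    change f - algebraMap k[X] K u * (algebraMap k[X] K s * f) = _
    linear_combination (-f) * this
  rw [h1]
  have := mul_mem_boundedAtZeros
    (mul_mem_boundedAtZeros (hO (algebraMap k[X] K w) isIntegral_algebraMap) hf)
    (self_mem_boundedAtZeros (k := k) y (y ^ n))
  rw [one_mul, one_mul] at this
  exact this

end Zeros

end Infrastructure.FF

namespace Infrastructure.FF

/-! ### The same facts for another embedding of `k(X)` into `K` -/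

section Embedding

variable {k K : Type*} [Field k] [Field K] [Algebra k K] {φ : k⟮X⟯ →+* K}

/-- The algebra structures on `K` are replaced locally by those coming from `φ`. With `φ X = 1 / x`,
statements about zeros become statements about the poles of `x`. -/
theorem exists_isIntegralElem_mul (hφ : φ.Finite)
    (hC : ∀ c, φ (RatFunc.C c) = algebraMap k K c) {f : K}
    (hf : f ∈ boundedAtZeros k (φ RatFunc.X) 1) :
    ∃ s : k[X], s.coeff 0 ≠ 0 ∧
      (φ.comp (algebraMap k[X] k⟮X⟯)).IsIntegralElem (φ (algebraMap k[X] k⟮X⟯ s) * f) := by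
  let _ : Algebra k⟮X⟯ K := φ.toAlgebra
  let _ : Algebra k[X] K := (φ.comp (algebraMap k[X] k⟮X⟯)).toAlgebra
  have : IsScalarTower k k[X] K := IsScalarTower.of_algebraMap_eq fun c ↦ (hC c).symm
  have : IsScalarTower k[X] k⟮X⟯ K := IsScalarTower.of_algebraMap_eq fun _ ↦ rfl
  have : FunctionField k K := hφ
  exact exists_isIntegral_mul (k := k) hf

theorem Place.deg_pos_of_val_map_X_lt_one (hφ : φ.Finite)
    (hC : ∀ c, φ (RatFunc.C c) = algebraMap k K c) (p : Place k K)
    (hp : p.val (φ RatFunc.X) < 1) : 0 < p.deg := by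
  let _ : Algebra k⟮X⟯ K := φ.toAlgebra
  let _ : Algebra k[X] K := (φ.comp (algebraMap k[X] k⟮X⟯)).toAlgebra
  have : IsScalarTower k k[X] K := IsScalarTower.of_algebraMap_eq fun c ↦ (hC c).symm
  have : IsScalarTower k[X] k⟮X⟯ K := IsScalarTower.of_algebraMap_eq fun _ ↦ rfl
  have : FunctionField k K := hφ
  exact p.deg_pos_of_val_X_lt_one hp

theorem finiteDimensional_map_mkQ_boundedAtZeros_map_X (hφ : φ.Finite)
    (hC : ∀ c, φ (RatFunc.C c) = algebraMap k K c) (n : ℕ) :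
    FiniteDimensional k ((boundedAtZeros k (φ RatFunc.X) 1).map
      (boundedAtZeros k (φ RatFunc.X) (φ RatFunc.X ^ n)).mkQ) := by
  let _ : Algebra k⟮X⟯ K := φ.toAlgebra
  let _ : Algebra k[X] K := (φ.comp (algebraMap k[X] k⟮X⟯)).toAlgebra
  have : IsScalarTower k k[X] K := IsScalarTower.of_algebraMap_eq fun c ↦ (hC c).symm
  have : IsScalarTower k[X] k⟮X⟯ K := IsScalarTower.of_algebraMap_eq fun _ ↦ rfl
  have : FunctionField k K := hφ
  exact finiteDimensional_map_mkQ_boundedAtZeros (k := k) (K := K) n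

end Embedding

/-! ### The substitution `X ↦ 1 / X` and the valuation at infinity -/

section InvX

variable (k : Type*) [Field k]

theorem transcendental_X_inv : Transcendental k (RatFunc.X⁻¹ : k⟮X⟯) := fun h ↦
  RatFunc.transcendental_X (by simpa using h.inv)

/-- The endomorphism of `k(X)` that maps `X` to `1 / X`. -/
def invX : k⟮X⟯ →+* k⟮X⟯ :=
  RatFunc.liftRingHom (Polynomial.aeval (RatFunc.X⁻¹ : k⟮X⟯)).toRingHom fun g hg ↦ by
    rw [Submonoid.mem_comap, mem_nonZeroDivisors_iff_ne_zero]
    intro h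
    exact nonZeroDivisors.ne_zero hg
      ((transcendental_iff.mp (transcendental_X_inv k)) g h)

theorem invX_algebraMap (g : k[X]) :
    invX k (algebraMap k[X] k⟮X⟯ g) = Polynomial.aeval RatFunc.X⁻¹ g :=
  RatFunc.liftRingHom_algebraMap _ _ g

theorem invX_X : invX k RatFunc.X = RatFunc.X⁻¹ := by
  rw [← RatFunc.algebraMap_X, invX_algebraMap, Polynomial.aeval_X, RatFunc.algebraMap_X]

theorem invX_C (c : k) : invX k (RatFunc.C c) = RatFunc.C c := by
  rw [← RatFunc.algebraMap_C, invX_algebraMap, Polynomial.aeval_C, RatFunc.algebraMap_C,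
    RatFunc.algebraMap_eq_C]

theorem invX_surjective : Function.Surjective (invX k) := by
  have hX : RatFunc.X ∈ (invX k).fieldRange :=
    ⟨RatFunc.X⁻¹, by rw [map_inv₀, invX_X, inv_inv]⟩
  have hpoly : ∀ g : k[X], algebraMap k[X] k⟮X⟯ g ∈ (invX k).fieldRange := by
    intro g
    induction g using Polynomial.induction_on' with
    | add g h hg hh => rw [map_add]; exact add_mem hg hh
    | monomial n c =>
      rw [RatFunc.algebraMap_monomial]
      exact mul_mem ⟨RatFunc.C c, invX_C k c⟩ (pow_mem hX n)
  intro f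
  rw [← RatFunc.num_div_denom f]
  exact div_mem (hpoly _) (hpoly _)

open Classical in
theorem inftyValuation_invX_algebraMap_le_one (g : k[X]) :
    RatFunc.inftyValuation k (invX k (algebraMap k[X] k⟮X⟯ g)) ≤ 1 := by
  rw [invX_algebraMap]
  induction g using Polynomial.induction_on' with
  | add g h hg hh => rw [map_add]; exact Valuation.map_add_le _ hg hh
  | monomial n c =>
    rw [Polynomial.aeval_monomial, map_mul, map_pow, map_inv₀, RatFunc.inftyValuation.X]
    refine mul_le_one' (Valuation.IsTrivialOn.valuation_algebraMap_le_one _ c)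
      (pow_le_one' ?_ n)
    rw [← WithZero.exp_neg, ← WithZero.exp_zero, WithZero.exp_le_exp]
    simp

-- In `s(1/X)` the non-zero constant term dominates, every other term having a zero at infinity.
open Classical in
theorem inftyValuation_invX_algebraMap {s : k[X]} (hs : s.coeff 0 ≠ 0) :
    RatFunc.inftyValuation k (invX k (algebraMap k[X] k⟮X⟯ s)) = 1 := by
  have h1 : RatFunc.inftyValuation k (RatFunc.C (s.coeff 0)) = 1 :=
    RatFunc.inftyValuation.C k hs
  rw [← s.divX_mul_X_add, map_add, map_add, RatFunc.algebraMap_C, invX_C,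
    Valuation.map_add_eq_of_lt_right, h1]
  rw [h1, map_mul, map_mul, RatFunc.algebraMap_X, invX_X, map_mul, map_inv₀,
    RatFunc.inftyValuation.X]
  refine mul_lt_one_of_nonneg_of_lt_one_right (inftyValuation_invX_algebraMap_le_one k _)
    zero_le ?_
  rw [← WithZero.exp_neg, ← WithZero.exp_zero, WithZero.exp_lt_exp]
  simp

end InvX

/-! ### Integral functions with bounded poles at infinity -/

section Integers

open FunctionField (ringOfIntegers)

variable {k K : Type*} [Field k] [Field K] [Algebra k K] [Algebra k[X] K] [IsScalarTower k k[X] K]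

variable (k K) in
/-- The integral functions whose poles above infinity are bounded by those of `x ^ n`. -/
def integersBounded (n : ℕ) : Submodule k (ringOfIntegers k K) :=
  (boundedAtZeros k (algebraMap k[X] K Polynomial.X)⁻¹
    (algebraMap k[X] K Polynomial.X ^ n)).comap
    (IsScalarTower.toAlgHom k (ringOfIntegers k K) K).toLinearMap

theorem mem_integersBounded {n : ℕ} {a : ringOfIntegers k K} :
    a ∈ integersBounded k K n ↔
      (a : K) ∈ boundedAtZeros k (algebraMap k[X] K Polynomial.X)⁻¹
        (algebraMap k[X] K Polynomial.X ^ n) := Iff.rfl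

theorem Place.val_algebraMap_polynomial (p : Place k K)
    (hp : 1 < p.val (algebraMap k[X] K Polynomial.X)) {g : k[X]} (hg : g ≠ 0) :
    p.val (algebraMap k[X] K g) = p.val (algebraMap k[X] K Polynomial.X) ^ g.natDegree := by
  have := p.trivial
  rw [← Polynomial.valuation_aeval_eq_valuation_X_pow_natDegree_of_one_lt_valuation_X _ hp hg,
    Polynomial.aeval_algebraMap_apply, Polynomial.aeval_X_left_apply]

theorem Place.val_algebraMap_polynomial_le (p : Place k K)
    (hp : 1 < p.val (algebraMap k[X] K Polynomial.X)) {g : k[X]} {n : ℕ} (hg : g.natDegree ≤ n) :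
    p.val (algebraMap k[X] K g) ≤ p.val (algebraMap k[X] K Polynomial.X) ^ n := by
  rcases eq_or_ne g 0 with rfl | h0
  · simp
  · rw [p.val_algebraMap_polynomial hp h0]
    exact pow_le_pow_right₀ hp.le hg

end Integers

/-! ### Poles of `x`: finite dimension of `W` and `O = W + abO` -/

section Poles

open FunctionField (ringOfIntegers)

variable {k K : Type*} [Field k] [Field K] [Algebra k⟮X⟯ K]

theorem finite_comp_invX [FunctionField k K] : ((algebraMap k⟮X⟯ K).comp (invX k)).Finite :=
  RingHom.Finite.comp (RingHom.finite_algebraMap.mpr inferInstance)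
    (RingHom.Finite.of_surjective _ (invX_surjective k))

variable [Algebra k[X] K] [IsScalarTower k[X] k⟮X⟯ K]

theorem algebraMap_X_ne_zero : algebraMap k[X] K Polynomial.X ≠ 0 := fun h ↦
  Polynomial.X_ne_zero (FunctionField.algebraMap_injective k K (h.trans (map_zero _).symm))

theorem comp_invX_X : (algebraMap k⟮X⟯ K).comp (invX k) RatFunc.X =
    (algebraMap k[X] K Polynomial.X)⁻¹ := by
  rw [RingHom.comp_apply, invX_X, map_inv₀, ← RatFunc.algebraMap_X,
    ← IsScalarTower.algebraMap_apply]

variable [Algebra k K]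

theorem Place.val_X_inv_lt_one_iff (p : Place k K) :
    p.val (algebraMap k[X] K Polynomial.X)⁻¹ < 1 ↔ 1 < p.val (algebraMap k[X] K Polynomial.X) := by
  rw [map_inv₀]
  exact inv_lt_one₀ (by simpa [zero_lt_iff] using algebraMap_X_ne_zero (k := k) (K := K))

variable [IsScalarTower k k[X] K]

theorem comp_invX_C (c : k) :
    (algebraMap k⟮X⟯ K).comp (invX k) (RatFunc.C c) = algebraMap k K c := by
  rw [RingHom.comp_apply, invX_C, ← RatFunc.algebraMap_C, ← IsScalarTower.algebraMap_apply,
    ← Polynomial.algebraMap_eq, ← IsScalarTower.algebraMap_apply]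

/-- If `f` had a worse pole than `x ^ m`, with `m` at least the degree of every lower coefficient of
an integral equation, the leading term would strictly dominate all others. The bound serves all
infinite places at once. -/
theorem exists_mem_boundedAtZeros_of_isIntegral {f : K} (hf : IsIntegral k[X] f) :
    ∃ n : ℕ, ∀ m ≥ n, f ∈ boundedAtZeros k (algebraMap k[X] K Polynomial.X)⁻¹
      (algebraMap k[X] K Polynomial.X ^ m) := by
  obtain ⟨g, hg, hgf⟩ := hf
  refine ⟨(Finset.range g.natDegree).sup fun i ↦ (g.coeff i).natDegree, fun m hm p hp ↦ ?_⟩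
  rw [p.val_X_inv_lt_one_iff] at hp
  rw [map_pow]
  by_contra! hlt
  have h1 : 1 < p.val f := (one_le_pow_of_one_le' hp.le m).trans_lt hlt
  have hsum : f ^ g.natDegree =
      -∑ i ∈ Finset.range g.natDegree, algebraMap k[X] K (g.coeff i) * f ^ i := by
    rw [Polynomial.eval₂_eq_sum_range, Finset.sum_range_succ, hg.coeff_natDegree, map_one,
      one_mul] at hgf
    linear_combination hgf
  have hv := congrArg p.val hsum
  rw [Valuation.map_neg, map_pow] at hv
  refine (Valuation.map_sum_lt p.val (pow_ne_zero _ (zero_lt_one.trans h1).ne')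
    fun i hi ↦ ?_).ne hv.symm
  rw [map_mul, map_pow]
  have hc := p.val_algebraMap_polynomial_le hp
    ((Finset.le_sup (f := fun i ↦ (g.coeff i).natDegree) hi).trans hm)
  have hpos : 0 < p.val f ^ i := pow_pos (zero_lt_one.trans h1) i
  calc _ < p.val f * p.val f ^ i := mul_lt_mul_of_pos_right (hc.trans_lt hlt) hpos
    _ = p.val f ^ (i + 1) := (pow_succ' _ _).symm
    _ ≤ _ := pow_le_pow_right₀ h1.le (Finset.mem_range.mp hi)

theorem exists_sub_mem_boundedAtZeros (c : k⟮X⟯) :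
    ∃ g : k[X], algebraMap k⟮X⟯ K c - algebraMap k[X] K g ∈
      boundedAtZeros k (algebraMap k[X] K Polynomial.X)⁻¹ 1 := by
  -- The polynomial part of `c`; what remains is a proper fraction, which has no pole at infinity.
  refine ⟨c.num / c.denom, fun p hp ↦ ?_⟩
  rw [p.val_X_inv_lt_one_iff] at hp
  have hd : algebraMap k[X] K c.denom ≠ 0 := fun h ↦
    c.denom_ne_zero (FunctionField.algebraMap_injective k K (h.trans (map_zero _).symm))
  have h1 : algebraMap k⟮X⟯ K c - algebraMap k[X] K (c.num / c.denom) =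
      algebraMap k[X] K (c.num % c.denom) / algebraMap k[X] K c.denom := by
    nth_rw 1 [← RatFunc.num_div_denom c]
    rw [map_div₀, ← IsScalarTower.algebraMap_apply, ← IsScalarTower.algebraMap_apply,
      eq_div_iff hd, sub_mul, div_mul_cancel₀ _ hd, ← map_mul, ← map_sub]
    congr 1
    linear_combination -EuclideanDomain.div_add_mod c.num c.denom
  rw [h1, map_div₀, map_one]
  have hd' : 0 < p.val (algebraMap k[X] K c.denom) := by simpa [zero_lt_iff] using hd
  rw [div_le_one₀ hd', p.val_algebraMap_polynomial hp c.denom_ne_zero]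
  refine p.val_algebraMap_polynomial_le hp ?_
  exact Polynomial.natDegree_le_natDegree (EuclideanDomain.mod_lt _ c.denom_ne_zero).le

variable [FunctionField k K]

theorem Place.deg_pos_of_one_lt_val_X (p : Place k K)
    (hp : 1 < p.val (algebraMap k[X] K Polynomial.X)) : 0 < p.deg := by
  refine Place.deg_pos_of_val_map_X_lt_one finite_comp_invX comp_invX_C p ?_
  rw [comp_invX_X]
  exact p.val_X_inv_lt_one_iff.mpr hp

/-- An integral function that vanishes at all poles of `x` is zero. -/
theorem eq_zero_of_isIntegral_of_mem_boundedAtZeros {f : K} (hf : IsIntegral k[X] f)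
    (hfy : f ∈ boundedAtZeros k (algebraMap k[X] K Polynomial.X)⁻¹
      (algebraMap k[X] K Polynomial.X)⁻¹) : f = 0 := by
  classical
  set x := algebraMap k[X] K Polynomial.X with hx
  have hx0 : x ≠ 0 := algebraMap_X_ne_zero
  -- The idea is to compare norms to `k(X)`. The norm of `f` is a polynomial `g`. As `xf` is regular
  -- at infinity, some `s(1/x)xf` with `s(0) ≠ 0` is integral over the valuation ring at infinity,
  -- and so is its norm.
  have hxf : x * f ∈ boundedAtZeros k ((algebraMap k⟮X⟯ K).comp (invX k) RatFunc.X) 1 := by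
    have := mul_mem_boundedAtZeros (self_mem_boundedAtZeros (k := k) x⁻¹ x) hfy
    rwa [mul_inv_cancel₀ hx0, ← comp_invX_X] at this
  obtain ⟨s, hs0, hs⟩ := exists_isIntegralElem_mul finite_comp_invX comp_invX_C hxf
  have hint := isIntegral_valuationSubring (L := K) (RatFunc.inftyValuation k)
    ((invX k).comp (algebraMap k[X] k⟮X⟯)) (inftyValuation_invX_algebraMap_le_one k) hs
  obtain ⟨z, hz⟩ := IsIntegrallyClosed.isIntegral_iff.mp (Algebra.isIntegral_norm k⟮X⟯ hint)
  obtain ⟨g, hg⟩ := IsIntegrallyClosed.isIntegral_iff.mp (Algebra.isIntegral_norm k⟮X⟯ hf)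
  have hxX : x = algebraMap k⟮X⟯ K RatFunc.X := by
    rw [hx, ← RatFunc.algebraMap_X, ← IsScalarTower.algebraMap_apply]
  rw [RingHom.comp_apply, map_mul, map_mul, hxX, Algebra.norm_algebraMap, Algebra.norm_algebraMap,
    ← hg] at hz
  have hz1 : RatFunc.inftyValuation k z ≤ 1 := z.2
  change (z : k⟮X⟯) = _ at hz
  rw [hz, map_mul, map_mul, map_pow, map_pow, inftyValuation_invX_algebraMap k hs0, one_pow,
    one_mul, RatFunc.inftyValuation.X] at hz1
  -- The norm of `s(1/x)xf` is a unit at infinity times `X ^ [K : k(X)] g`, which has a pole there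
  -- unless `g = 0`.
  have hg0 : g = 0 := by
    by_contra hg0
    rw [RatFunc.inftyValuation_apply, RatFunc.inftyValuation.polynomial k hg0, ← WithZero.exp_nsmul,
      ← WithZero.exp_add, ← WithZero.exp_zero, WithZero.exp_le_exp] at hz1
    have : 0 < Module.finrank k⟮X⟯ K := Module.finrank_pos
    simp at hz1
    omega
  rw [hg0, map_zero] at hg
  exact Algebra.norm_eq_zero_iff.mp hg.symm

instance finiteDimensional_integersBounded (n : ℕ) :
    FiniteDimensional k (integersBounded k K n) := by
  -- Multiplication by `x⁻¹ ^ n` sends `W` into the functions regular at infinity. Working modulo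
  -- `x⁻¹ ^ (n + 1)` rather than `x⁻¹ ^ n` makes the map injective: elements of its kernel are
  -- integral and vanish at infinity, whereas exponent `n` would leave the constants.
  have hfin := finiteDimensional_map_mkQ_boundedAtZeros_map_X
    (finite_comp_invX (k := k) (K := K)) comp_invX_C (n + 1)
  rw [comp_invX_X] at hfin
  have hx0 : algebraMap k[X] K Polynomial.X ≠ 0 := algebraMap_X_ne_zero
  set x := algebraMap k[X] K Polynomial.X with hx
  let T : integersBounded k K n →ₗ[k] K ⧸ boundedAtZeros k x⁻¹ (x⁻¹ ^ (n + 1)) :=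
    (boundedAtZeros k x⁻¹ (x⁻¹ ^ (n + 1))).mkQ ∘ₗ LinearMap.mulLeft k (x⁻¹ ^ n) ∘ₗ
      (IsScalarTower.toAlgHom k (ringOfIntegers k K) K).toLinearMap ∘ₗ Submodule.subtype _
  have hT : ∀ a, T a = Submodule.Quotient.mk (x⁻¹ ^ n * (a.1 : K)) := fun a ↦ rfl
  have hmem : ∀ a, T a ∈ (boundedAtZeros k x⁻¹ 1).map
      (boundedAtZeros k x⁻¹ (x⁻¹ ^ (n + 1))).mkQ := fun a ↦ by
    refine ⟨x⁻¹ ^ n * (a.1 : K), ?_, (hT a).symm⟩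
    have := mul_mem_boundedAtZeros (self_mem_boundedAtZeros (k := k) x⁻¹ (x⁻¹ ^ n))
      (mem_integersBounded.mp a.2)
    rwa [← mul_pow, inv_mul_cancel₀ hx0, one_pow] at this
  refine Module.Finite.of_injective (T.codRestrict _ hmem) ?_
  refine (injective_iff_map_eq_zero _).mpr fun a ha ↦ ?_
  replace ha : T a = 0 := congrArg Subtype.val ha
  rw [hT, Submodule.Quotient.mk_eq_zero] at ha
  have h1 := mul_mem_boundedAtZeros (self_mem_boundedAtZeros (k := k) x⁻¹ (x ^ n)) ha
  rw [← mul_assoc, ← mul_pow, mul_inv_cancel₀ hx0, one_pow, one_mul, pow_succ, ← mul_assoc,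
    ← mul_pow, mul_inv_cancel₀ hx0, one_pow, one_mul] at h1
  exact Subtype.ext (Subtype.ext (eq_zero_of_isIntegral_of_mem_boundedAtZeros a.1.2 h1))

/-- Expand `b / (ad)` in a basis of `K` over `k(X)` that `d` makes integral, and let `g` collect the
polynomial parts of the coordinates. The remainder is a combination of fixed integral functions with
coefficients regular at infinity, so one `n` serves every `b`. -/
theorem exists_sub_mul_mem_integersBounded {a : ringOfIntegers k K} (ha : a ≠ 0) :
    ∃ n : ℕ, ∀ b : ringOfIntegers k K, ∃ g, b - a * g ∈ integersBounded k K n := by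
  classical
  let e := Module.finBasis k⟮X⟯ K
  obtain ⟨d, hd0, hd⟩ := exists_integral_multiples k[X] k⟮X⟯ (Finset.univ.image e)
  have hd' : ∀ i, IsIntegral k[X] (d • e i) := fun i ↦
    hd _ (Finset.mem_image_of_mem _ (Finset.mem_univ i))
  let e' : Fin (Module.finrank k⟮X⟯ K) → ringOfIntegers k K := fun i ↦ ⟨d • e i, hd' i⟩
  have he' : ∀ i, (e' i : K) = algebraMap k[X] K d * e i := fun i ↦ Algebra.smul_def _ _
  have had : (a : K) * algebraMap k[X] K d ≠ 0 := by
    refine mul_ne_zero (fun h ↦ ha (Subtype.ext h)) fun h ↦ hd0 ?_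
    exact FunctionField.algebraMap_injective k K (h.trans (map_zero _).symm)
  choose N hN using fun i ↦ exists_mem_boundedAtZeros_of_isIntegral (a * e' i).2
  refine ⟨Finset.univ.sup N, fun b ↦ ?_⟩
  let c := e.repr ((b : K) / (a * algebraMap k[X] K d))
  have hc := e.sum_repr ((b : K) / (a * algebraMap k[X] K d))
  choose g hg using fun i ↦ exists_sub_mem_boundedAtZeros (K := K) (c i)
  refine ⟨∑ i, algebraMap k[X] (ringOfIntegers k K) (g i) * e' i, ?_⟩
  have hb : ((b - a * ∑ i, algebraMap k[X] (ringOfIntegers k K) (g i) * e' i :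
      ringOfIntegers k K) : K) =
      ∑ i, (algebraMap k⟮X⟯ K (c i) - algebraMap k[X] K (g i)) *
        ((a * e' i : ringOfIntegers k K) : K) := by
    have h1 : (b : K) = ∑ i, algebraMap k⟮X⟯ K (c i) * (a * e' i) := by
      rw [eq_div_iff had, Finset.sum_mul] at hc
      rw [← hc]
      refine Finset.sum_congr rfl fun i _ ↦ ?_
      rw [Algebra.smul_def, he']
      ring
    have h2 : ((∑ i, algebraMap k[X] (ringOfIntegers k K) (g i) * e' i : ringOfIntegers k K) : K) =
        ∑ i, algebraMap k[X] K (g i) * e' i := by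
      change algebraMap (ringOfIntegers k K) K _ = _
      rw [map_sum]
      rfl
    change (b : K) - a * _ = _
    rw [h2, h1, Finset.mul_sum, ← Finset.sum_sub_distrib]
    refine Finset.sum_congr rfl fun i _ ↦ ?_
    change _ = _ * ((a : K) * e' i)
    ring
  rw [mem_integersBounded, hb]
  refine Submodule.sum_mem _ fun i _ ↦ ?_
  have := mul_mem_boundedAtZeros (hg i) (hN i _ (Finset.le_sup (Finset.mem_univ i)))
  rwa [one_mul] at this

/-- Membership in `W` is tested only at the poles of `x`, where `ac` and `bc` have equal valuations.
-/
theorem finrank_quotient_span_eq_of_val_eq {a b : ringOfIntegers k K} (ha : a ≠ 0) (hb : b ≠ 0)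
    (hab : ∀ p : Place k K, 1 < p.val (algebraMap k[X] K Polynomial.X) → p.val a = p.val b) :
    Module.finrank k (ringOfIntegers k K ⧸ Ideal.span {a}) =
      Module.finrank k (ringOfIntegers k K ⧸ Ideal.span {b}) := by
  obtain ⟨n, hn⟩ := exists_sub_mul_mem_integersBounded (mul_ne_zero ha hb)
  refine finrank_quotient_span_eq (W := integersBounded k K n) ha hb (fun c ↦ ?_) hn
  rw [mem_integersBounded, mem_integersBounded]
  refine forall₂_congr fun p hp ↦ ?_
  rw [p.val_X_inv_lt_one_iff] at hp
  change p.val ((a : K) * c) ≤ _ ↔ p.val ((b : K) * c) ≤ _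
  rw [map_mul, map_mul, hab p hp]

theorem weightedDegree_eq_finrank {I : Ideal (ringOfIntegers k K)} (hI : I ≠ 0) :
    weightedDegree (fun P ↦ ((finitePlace P).deg : ℝ))
      (I : FractionalIdeal (ringOfIntegers k K)⁰ K) =
      Module.finrank k (ringOfIntegers k K ⧸ I) := by
  refine weightedDegree_coeIdeal _
    (f := fun I ↦ (Module.finrank k (ringOfIntegers k K ⧸ I) : ℝ)) ?_ ?_ hI
  · have : Subsingleton (ringOfIntegers k K ⧸ (1 : Ideal (ringOfIntegers k K))) :=
      Ideal.Quotient.subsingleton_iff.mpr Ideal.one_eq_top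
    exact_mod_cast Module.finrank_zero_of_subsingleton
  · intro P J hJ
    have hmul : P.asIdeal * J ≠ 0 := mul_ne_zero P.ne_bot hJ
    rw [finrank_quotient_mul P.ne_bot hJ (finiteDimensional_quotient hmul), deg_finitePlace]
    push_cast
    rfl

end Poles

/-! ### Function fields: conclusion -/

section Main

universe u

variable {k : Type*} {K : Type u} [Field k] [Field K] [Algebra k K] [Algebra k[X] K]
    [IsScalarTower k k[X] K] [Algebra k⟮X⟯ K] [IsScalarTower k[X] k⟮X⟯ K] [FunctionField k K]

open FunctionField (ringOfIntegers)

theorem val_eq_one_of_absVal_eq_one {q : ℝ} (hq : 1 < q) {h : K} (h0 : h ≠ 0) (p : Place k K)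
    (hp : 1 < p.val (algebraMap k[X] K Polynomial.X))
    (habs : (infinitePlaces k K q).absVal ⟨p, hp⟩ h = 1) : p.val h = 1 := by
  replace habs : q ^ (-(p.ord h : ℝ) * (p.deg : ℝ)) = 1 := (if_neg h0).symm.trans habs
  -- `|h| = 1` only says `ν(h) * deg = 0`; a non-zero degree is needed to recover `ν(h) = 0`.
  have hdeg : (p.deg : ℝ) ≠ 0 := by exact_mod_cast (p.deg_pos_of_one_lt_val_X hp).ne'
  have hexp : -(p.ord h : ℝ) * (p.deg : ℝ) = 0 := by
    have := congrArg Real.log habs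
    rw [Real.log_rpow (by linarith), Real.log_one] at this
    exact (mul_eq_zero.mp this).resolve_right (Real.log_pos hq).ne'
  have hord : p.ord h = 0 := by
    exact_mod_cast neg_eq_zero.mp ((mul_eq_zero.mp hexp).resolve_right hdeg)
  have hv : p.val h ≠ 0 := by simpa using h0
  rw [Place.ord, neg_eq_zero] at hord
  rw [← WithZero.exp_log hv, hord, WithZero.exp_zero]

theorem weightedDegree_spanSingleton {q : ℝ} (hq : 1 < q) {h : K} (h0 : h ≠ 0)
    (hp : ∀ p, (infinitePlaces k K q).absVal p h = 1) :
    weightedDegree (fun P ↦ ((finitePlace P).deg : ℝ))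
      (FractionalIdeal.spanSingleton (ringOfIntegers k K)⁰ h) = 0 := by
  obtain ⟨a, b, hb, rfl⟩ := IsFractionRing.div_surjective (A := ringOfIntegers k K) h
  have hb0 : b ≠ 0 := nonZeroDivisors.ne_zero hb
  have ha0 : a ≠ 0 := by
    rintro rfl
    simp at h0
  rw [weightedDegree_spanSingleton_div _ ha0 hb0, weightedDegree_eq_finrank (by simpa using ha0),
    weightedDegree_eq_finrank (by simpa using hb0), sub_eq_zero, Nat.cast_inj]
  refine finrank_quotient_span_eq_of_val_eq ha0 hb0 fun p hpx ↦ ?_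
  have := val_eq_one_of_absVal_eq_one hq h0 p hpx (hp ⟨p, hpx⟩)
  rw [map_div₀] at this
  exact eq_of_div_eq_one this

theorem degree_idealDivisor (b : FractionalIdeal (ringOfIntegers k K)⁰ K) :
    ((idealDivisor b).degree : ℝ) =
      -weightedDegree (fun P ↦ ((finitePlace P).deg : ℝ)) b := by
  rw [Divisor.degree, idealDivisor, Finsupp.sum_neg_index (by simp)]
  -- The summand is additive in the coefficient, so the sum transfers without injectivity of
  -- `finitePlace`.
  rw [Finsupp.sum_mapDomain_index (by simp) (by intros; ring), weightedDegree]
  simp [Finsupp.sum]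

theorem equivalent_iff {q : ℝ} (hq : 1 < q) {b b' : FractionalIdeal (ringOfIntegers k K)⁰ K}
    (hb : (infinitePlaces k K q).IsReduced b) (hb' : (infinitePlaces k K q).IsReduced b') :
    (infinitePlaces k K q).Equivalent b b' ↔
      (infinitePlaces k K q).box (b * b'⁻¹) (fun _ ↦ 0) ≠ {0} ∧
        (idealDivisor b).degree = (idealDivisor b').degree := by
  rw [← Int.cast_inj (α := ℝ), degree_idealDivisor, degree_idealDivisor, neg_inj]
  refine InfinitePlaces.equivalent_iff (fun P ↦ ?_) (fun p ↦ ?_)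
    (fun _ ↦ weightedDegree_spanSingleton hq) hb hb'
  · rw [deg_finitePlace]
    exact_mod_cast finrank_quotient_pos P
  · change ((p.1.ord 1 : ℤ) : ℝ) = 0
    simp [Place.ord]

end Main

end Infrastructure.FF

end

theorem proposition5p3 :
    -- number fields
    (∀ (K : Type*) [Field K] [NumberField K] (b b' : FractionalIdeal (𝓞 K)⁰ K),
      (Infrastructure.NF.infinitePlaces K).IsReduced b →
      (Infrastructure.NF.infinitePlaces K).IsReduced b' →
      ((Infrastructure.NF.infinitePlaces K).Equivalent b b' ↔
        (Infrastructure.NF.infinitePlaces K).box (b * b'⁻¹) (fun _ ↦ 0) ≠ {0} ∧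
        (Infrastructure.NF.idealDivisor b).degree = (Infrastructure.NF.idealDivisor b').degree)) ∧
    -- function fields over an arbitrary exact field of constants
    (∀ (k K : Type*) [Field k] [Field K] [Algebra k K] [Algebra k[X] K] [IsScalarTower k k[X] K]
      [Algebra k⟮X⟯ K] [IsScalarTower k[X] k⟮X⟯ K] [FunctionField k K]
      (_ : ∀ y : K, IsAlgebraic k y → y ∈ Set.range (algebraMap k K))
      (q : ℝ) (_ : 1 < q) (b b' : FractionalIdeal (FunctionField.ringOfIntegers k K)⁰ K),
      (Infrastructure.FF.infinitePlaces k K q).IsReduced b →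
      (Infrastructure.FF.infinitePlaces k K q).IsReduced b' →
      ((Infrastructure.FF.infinitePlaces k K q).Equivalent b b' ↔
        (Infrastructure.FF.infinitePlaces k K q).box (b * b'⁻¹) (fun _ ↦ 0) ≠ {0} ∧
        (Infrastructure.FF.idealDivisor b).degree = (Infrastructure.FF.idealDivisor b').degree)) := by
  exact ⟨fun K _ _ b b' hb hb' ↦ Infrastructure.NF.equivalent_iff hb hb',
    fun k K _ _ _ _ _ _ _ _ _ q hq b b' hb hb' ↦ Infrastructure.FF.equivalent_iff hq hb hb'⟩
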